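/- Let $\mathcal{P}$ be a finite-dimensional real unital commutative algebra together with a unital algebra homomorphism ${}^\# : \mathcal{P} \to \mathbb{R}$ whose kernel $\mathcal{I}$ is nilpotent ($\mathcal{I}^N = 0$ for some $N \in \mathbb{N}$), and let $\mathcal{P}^{\mathbb{C}} = \mathcal{P} \otimes_{\mathbb{R}} \mathbb{C}$. A $\mathcal{P}$-Riemann surface with body the one-dimensional complex manifold $M$ is a pair $\mathcal{X} = (M, \mathcal{S})$, where $\mathcal{S}$ is a sheaf of unital commutative $\mathcal{P}^{\mathbb{C}}$-algebras on $M$ that is locally isomorphic to $\mathcal{O}_M \otimes_{\mathbb{C}} \mathcal{P}^{\mathbb{C}}$; here $\mathcal{O}_M$ is the sheaf of holomorphic functions. The manifold $M$ itself is regarded as the $\mathcal{P}$-Riemann surface $(M, \mathcal{O}_M \otimes_{\mathbb{C}} \mathcal{P}^{\mathbb{C}})$. A $\mathcal{P}$-morphism $\Phi : (M, \mathcal{S}) \to_{\mathcal{P}} (N, \mathcal{T})$ consists of a holomorphic map $\varphi : M \to N$, called its body $\Phi^\#$, and unital $\mathcal{P}^{\mathbb{C}}$-algebra homomorphisms $\phi_V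 : \mathcal{T}(V) \to \mathcal{S}(\varphi^{-1}(V))$ for all open $V \subseteq N$, compatible with restrictions; it is a $\mathcal{P}$-isomorphism if it has a two-sided inverse $\mathcal{P}$-morphism. Let $\mathcal{X}$ be a $\mathcal{P}$-Riemann surface with body $\mathbb{P}^1$. Then there exists a $\mathcal{P}$-isomorphism $\Phi : \mathbb{P}^1 \to_{\mathcal{P}} \mathcal{X}$ with $\Phi^\# = \mathrm{id}$. -/

import Mathlib

open scoped Manifold ContDiff TensorProduct
open CategoryTheory TopologicalSpace Opposite

universe u v w

/-! ### The Riemann sphere as a complex manifold -/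

section RiemannSphere

/-- The complex projective line `ℙ¹`, as the one-point compactification `ℂ ∪ {∞}` of `ℂ`. -/
abbrev RiemannSphere : Type := OnePoint ℂ

namespace RiemannSphere

open Filter Topology Classical

/-- Inversion `z ↦ 1 / z` on `ℙ¹`, exchanging `0` and `∞`. -/
noncomputable def inversion (x : RiemannSphere) : RiemannSphere :=
  OnePoint.elim x ((0 : ℂ) : RiemannSphere)
    (fun z : ℂ => if z = 0 then OnePoint.infty else ((z⁻¹ : ℂ) : RiemannSphere))

@[simp] theorem inversion_infty : inversion OnePoint.infty = ((0 : ℂ) : RiemannSphere) := rfl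

@[simp] theorem inversion_zero : inversion ((0 : ℂ) : RiemannSphere) = OnePoint.infty := by
  simp [inversion]

theorem inversion_coe {z : ℂ} (hz : z ≠ 0) :
    inversion (z : RiemannSphere) = ((z⁻¹ : ℂ) : RiemannSphere) := by
  simp [inversion, hz]

theorem inversion_inversion (x : RiemannSphere) : inversion (inversion x) = x := by
  induction x using OnePoint.rec with
  | infty => simp
  | coe z =>
    by_cases hz : z = 0
    · subst hz; simp
    · rw [inversion_coe hz, inversion_coe (inv_ne_zero hz), inv_inv]

theorem tendsto_coe_cobounded :
    Tendsto (fun z : ℂ => (z : RiemannSphere)) (Bornology.cobounded ℂ) (𝓝 OnePoint.infty) := by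
  rw [Metric.cobounded_eq_cocompact, ← coclosedCompact_eq_cocompact]
  exact OnePoint.tendsto_coe_infty

theorem continuous_inversion : Continuous inversion := by
  rw [continuous_iff_continuousAt]
  intro x
  induction x using OnePoint.rec with
  | infty =>
    rw [OnePoint.continuousAt_infty', coclosedCompact_eq_cocompact,
      ← Metric.cobounded_eq_cocompact, inversion_infty]
    have h : Tendsto (fun z : ℂ => ((z⁻¹ : ℂ) : RiemannSphere)) (Bornology.cobounded ℂ)
        (𝓝 ((0 : ℂ) : RiemannSphere)) :=
      (OnePoint.continuous_coe.tendsto _).comp Filter.tendsto_inv₀_cobounded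
    refine h.congr' ?_
    filter_upwards [Bornology.isBounded_def.1 (Bornology.isBounded_singleton (x := (0 : ℂ)))] with z hz
    exact (inversion_coe hz).symm
  | coe z =>
    rw [OnePoint.continuousAt_coe]
    by_cases hz : z = 0
    · subst hz
      rw [continuousAt_iff_punctured_nhds]
      have h : Tendsto (fun z : ℂ => ((z⁻¹ : ℂ) : RiemannSphere)) (𝓝[≠] 0) (𝓝 OnePoint.infty) :=
        tendsto_coe_cobounded.comp Filter.tendsto_inv₀_nhdsNE_zero
      simp only [Function.comp, inversion_zero]
      refine h.congr' ?_
      filter_upwards [self_mem_nhdsWithin] with z hz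
      exact (inversion_coe hz).symm
    · have h : ContinuousAt (fun z : ℂ => ((z⁻¹ : ℂ) : RiemannSphere)) z :=
        OnePoint.continuous_coe.continuousAt.comp (continuousAt_inv₀ hz)
      refine h.congr ?_
      filter_upwards [isOpen_ne.mem_nhds hz] with w hw
      exact (inversion_coe hw).symm

/-- Inversion as a homeomorphism of `ℙ¹`. -/
noncomputable def inversionHomeomorph : RiemannSphere ≃ₜ RiemannSphere where
  toFun := inversion
  invFun := inversion
  left_inv := inversion_inversion
  right_inv := inversion_inversion
  continuous_toFun := continuous_inversion
  continuous_invFun := continuous_inversion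

/-- The affine chart `ℙ¹ ∖ {∞} → ℂ`, `z ↦ z`. -/
noncomputable def affineChart : OpenPartialHomeomorph RiemannSphere ℂ :=
  (OnePoint.isOpenEmbedding_coe.toOpenPartialHomeomorph ((↑) : ℂ → RiemannSphere)).symm

/-- The chart `ℙ¹ ∖ {0} → ℂ`, `z ↦ 1 / z`, `∞ ↦ 0`. -/
noncomputable def inftyChart : OpenPartialHomeomorph RiemannSphere ℂ :=
  inversionHomeomorph.toOpenPartialHomeomorph.trans affineChart

theorem affineChart_source : affineChart.source = {OnePoint.infty}ᶜ := by
  simp [affineChart, OnePoint.compl_infty]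

@[simp] theorem affineChart_target : affineChart.target = Set.univ := by
  simp [affineChart]

@[simp] theorem affineChart_symm_apply (z : ℂ) : affineChart.symm z = (z : RiemannSphere) := by
  simp [affineChart]

@[simp] theorem affineChart_coe (z : ℂ) : affineChart (z : RiemannSphere) = z := by
  rw [← affineChart_symm_apply, affineChart.right_inv (by simp)]

theorem inftyChart_apply (x : RiemannSphere) : inftyChart x = affineChart (inversion x) := rfl

theorem inftyChart_symm_apply (z : ℂ) : inftyChart.symm z = inversion (z : RiemannSphere) := by
  rw [← affineChart_symm_apply]; rfl

theorem mem_affineChart_source {x : RiemannSphere} : x ∈ affineChart.source ↔ x ≠ OnePoint.infty := by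
  simp [affineChart_source]

theorem mem_inftyChart_source {x : RiemannSphere} :
    x ∈ inftyChart.source ↔ x ≠ ((0 : ℂ) : RiemannSphere) := by
  have h : x ∈ inftyChart.source ↔ inversion x ∈ affineChart.source := by
    simp [inftyChart, inversionHomeomorph]
  rw [h, mem_affineChart_source, not_iff_not]
  constructor
  · intro hx; rw [← inversion_inversion x, hx, inversion_infty]
  · rintro rfl; simp

/-- The complex atlas of `ℙ¹` with the two charts `z` and `1 / z`. -/
noncomputable instance : ChartedSpace ℂ RiemannSphere where
  atlas := {affineChart, inftyChart}
  chartAt x := if x = OnePoint.infty then inftyChart else affineChart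
  mem_chart_source x := by
    split_ifs with h
    · rw [mem_inftyChart_source, h]; exact OnePoint.infty_ne_coe _
    · exact mem_affineChart_source.2 h
  chart_mem_atlas x := by split_ifs <;> simp

instance : IsManifold 𝓘(ℂ) ω RiemannSphere := by
  refine isManifold_of_contDiffOn _ _ _ ?_
  intro e e' he he'
  have key : ∀ s : Set ℂ, (∀ z ∈ s, z ≠ 0) → ContDiffOn ℂ ω (fun z : ℂ => z⁻¹) s :=
    fun s hs => contDiffOn_id.inv hs
  rcases he with rfl | he <;> rcases he' with rfl | he'
  · refine contDiffOn_id.congr ?_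
    intro z _; simp
  · rw [Set.mem_singleton_iff] at he'
    subst he'
    have hne : ∀ z ∈ (affineChart.symm.trans inftyChart).source, z ≠ 0 := by
      intro z hz
      have : affineChart.symm z ∈ inftyChart.source := hz.2
      rw [affineChart_symm_apply, mem_inftyChart_source] at this
      exact fun h => this (by rw [h])
    refine (key _ (fun z hz => hne z hz.1)).congr ?_
    intro z hz
    have := hne z hz.1
    simp [inftyChart_apply, inversion_coe this]
  · rw [Set.mem_singleton_iff] at he
    subst he
    have hne : ∀ z ∈ (inftyChart.symm.trans affineChart).source, z ≠ 0 := by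
      intro z hz
      have : inftyChart.symm z ∈ affineChart.source := hz.2
      rw [inftyChart_symm_apply, mem_affineChart_source] at this
      rintro rfl
      exact this inversion_zero
    refine (key _ (fun z hz => hne z hz.1)).congr ?_
    intro z hz
    have := hne z hz.1
    simp [inftyChart_symm_apply, inversion_coe this]
  · rw [Set.mem_singleton_iff] at he he'
    subst he he'
    refine contDiffOn_id.congr ?_
    intro z _
    simp [inftyChart_symm_apply, inftyChart_apply, inversion_inversion]

end RiemannSphere

end RiemannSphere

/-! ### Holomorphic functions with coefficients in the complexified parameter algebra -/

/-- The complexification `𝒫^ℂ = ℂ ⊗_ℝ 𝒫` of a real algebra `𝒫`. -/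
abbrev Complexification (P : Type u) [CommRing P] [Algebra ℝ P] : Type u := ℂ ⊗[ℝ] P

section Holomorphic

variable {M : Type v} [TopologicalSpace M] [ChartedSpace ℂ M]

/-- The `ℂ`-algebra `𝒪(U)` of holomorphic (i.e. complex analytic) functions on an open subset. -/
abbrev HolFun (U : Opens M) : Type v := C^ω⟮𝓘(ℂ), U; 𝓘(ℂ), ℂ⟯

/-- Restriction `𝒪(V) → 𝒪(U)` of holomorphic functions, for `U ⊆ V`. -/
noncomputable def HolFun.restrict {U V : Opens M} (h : U ≤ V) : HolFun V →ₐ[ℂ] HolFun U :=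
  { ContMDiffMap.restrictRingHom 𝓘(ℂ) 𝓘(ℂ) ℂ h with
    commutes' := fun _ => rfl }

@[simp] theorem HolFun.restrict_apply {U V : Opens M} (h : U ≤ V) (f : HolFun V) (x : U) :
    HolFun.restrict h f x = f ⟨x.1, h x.2⟩ := rfl

variable (P : Type u) [CommRing P] [Algebra ℝ P]

/-- The `𝒫^ℂ`-algebra `𝒫^ℂ ⊗_ℂ 𝒪(U)`. -/
abbrev PHolFun (U : Opens M) : Type (max u v) := Complexification P ⊗[ℂ] HolFun U

/-- Restriction `𝒫^ℂ ⊗ 𝒪(V) → 𝒫^ℂ ⊗ 𝒪(U)`, for `U ⊆ V`. -/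
noncomputable def PHolFun.restrict {U V : Opens M} (h : U ≤ V) :
    PHolFun P V →ₐ[Complexification P] PHolFun P U :=
  Algebra.TensorProduct.map (AlgHom.id _ _) (HolFun.restrict h)

variable (M)

/-- The presheaf `U ↦ 𝒫^ℂ ⊗_ℂ 𝒪(U)` of `𝒫^ℂ`-algebras on a complex manifold of dimension one. -/
noncomputable def pHolPresheaf :
    TopCat.Presheaf (CommAlgCat.{max u v} (Complexification P)) (TopCat.of M) where
  obj U := CommAlgCat.of _ (PHolFun P (M := M) U.unop)
  map i := CommAlgCat.ofHom (PHolFun.restrict P (M := M) i.unop.le)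
  map_id U := by
    apply CommAlgCat.hom_ext
    exact Algebra.TensorProduct.map_id
  map_comp i j := by
    apply CommAlgCat.hom_ext
    apply AlgHom.coe_ringHom_injective
    apply RingHom.ext
    intro x
    change PHolFun.restrict P (M := M) _ x =
      PHolFun.restrict P (M := M) j.unop.le (PHolFun.restrict P (M := M) i.unop.le x)
    induction x using TensorProduct.induction_on with
    | zero => simp
    | tmul a f => rfl
    | add x y hx hy => simp only [map_add, hx, hy]

/-- Unique gluing of holomorphic functions. -/
theorem HolFun.existsUnique_gluing {ι : Type w} (U : ι → Opens M) (f : ∀ i, HolFun (U i))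
    (hf : ∀ i j, HolFun.restrict (inf_le_left : U i ⊓ U j ≤ U i) (f i) =
      HolFun.restrict inf_le_right (f j)) :
    ∃! g : HolFun (iSup U), ∀ i, HolFun.restrict (le_iSup U i) g = f i := by
  have hmem : ∀ x : (iSup U : Opens M), ∃ i, x.1 ∈ U i := fun x => Opens.mem_iSup.1 x.2
  choose k hk using hmem
  have hval : ∀ (i : ι) (x : M) (hx : x ∈ U i) (hx' : x ∈ iSup U),
      f (k ⟨x, hx'⟩) ⟨x, hk ⟨x, hx'⟩⟩ = f i ⟨x, hx⟩ := fun i x hx hx' =>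
    DFunLike.congr_fun (hf (k ⟨x, hx'⟩) i) ⟨x, hk ⟨x, hx'⟩, hx⟩
  let F : M → ℂ := fun x => by
    classical
    exact if h : x ∈ iSup U then f (k ⟨x, h⟩) ⟨x, hk ⟨x, h⟩⟩ else 0
  have hF : ∀ (i : ι) (x : U i), F x = f i x := by
    intro i x
    have hx' : (x : M) ∈ iSup U := le_iSup U i x.2
    simp only [F, dif_pos hx']
    exact hval i x.1 x.2 hx'
  have hFs : ContMDiff 𝓘(ℂ) 𝓘(ℂ) ω (fun x : (iSup U : Opens M) => F x) := by
    intro x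
    obtain ⟨i, hi⟩ := Opens.mem_iSup.1 x.2
    rw [contMDiffAt_subtype_iff]
    have h := (f i).contMDiff ⟨x.1, hi⟩
    have h' : ContMDiffAt 𝓘(ℂ) 𝓘(ℂ) ω (fun y : U i => F y) ⟨x.1, hi⟩ := by
      have e : (fun y : U i => F y) = f i := funext (hF i)
      rw [e]; exact h
    exact (contMDiffAt_subtype_iff (x := (⟨x.1, hi⟩ : U i))).1 h'
  refine ⟨⟨_, hFs⟩, fun i => ContMDiffMap.ext fun x => hF i x, ?_⟩
  intro g hg
  refine ContMDiffMap.ext fun x => ?_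
  obtain ⟨i, hi⟩ := Opens.mem_iSup.1 x.2
  have h1 : g x = f i ⟨x.1, hi⟩ := DFunLike.congr_fun (hg i) ⟨x.1, hi⟩
  rw [h1]
  exact (hF i ⟨x.1, hi⟩).symm

/-- `U ↦ 𝒫^ℂ ⊗_ℂ 𝒪(U)` is a sheaf when `𝒫` is finite-dimensional. -/
theorem pHolPresheaf_isSheaf [Module.Finite ℝ P] :
    TopCat.Presheaf.IsSheaf
      (pHolPresheaf M P ⋙ forget (CommAlgCat.{max u v} (Complexification P))) := by
  apply TopCat.Presheaf.isSheaf_of_isSheafUniqueGluing_types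
  intro ι U sf hsf
  let b := Module.finBasis ℂ (Complexification P)
  let co : ∀ V : Opens M, PHolFun P V ≃ₗ[ℂ]
      (Fin (Module.finrank ℂ (Complexification P)) →₀ HolFun V) :=
    fun V => TensorProduct.equivFinsuppOfBasisLeft b
  have hco : ∀ {V W : Opens M} (h : W ≤ V) (s : PHolFun P V) i,
      co W (PHolFun.restrict P h s) i = HolFun.restrict h (co V s i) := by
    intro V W h s i
    induction s using TensorProduct.induction_on with
    | zero => simp
    | tmul a f => simp [co, PHolFun.restrict]
    | add x y hx hy => simp only [map_add, Finsupp.add_apply, hx, hy]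
  let sf' : ∀ i, PHolFun P (U i) := sf
  have hc : ∀ i j, PHolFun.restrict P (inf_le_left : U i ⊓ U j ≤ U i) (sf' i) =
      PHolFun.restrict P inf_le_right (sf' j) := hsf
  have hg := fun n => HolFun.existsUnique_gluing M U (fun i => co (U i) (sf' i) n)
    (fun i j => by rw [← hco, ← hco, hc])
  choose g hg hg' using hg
  refine ⟨(co (iSup U)).symm (Finsupp.equivFunOnFinite.symm g), ?_, ?_⟩
  · intro i
    change PHolFun.restrict P (le_iSup U i) _ = sf' i
    apply (co (U i)).injective
    ext n : 1
    rw [hco]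
    simpa using hg n i
  · intro t ht
    let t' : PHolFun P (iSup U) := t
    have ht' : ∀ i, PHolFun.restrict P (le_iSup U i) t' = sf' i := ht
    apply (co (iSup U)).injective
    ext n : 1
    rw [LinearEquiv.apply_symm_apply]
    refine hg' n (co (iSup U) t' n) fun i => ?_
    rw [← hco, ht']

end Holomorphic

/-! ### `𝒫`-Riemann surfaces and their morphisms -/

/-- A `𝒫`-Riemann surface with body the one-dimensional complex manifold `M`: a sheaf of
commutative `𝒫^ℂ`-algebras on `M` which is locally isomorphic to `𝒪_M ⊗ 𝒫^ℂ`. -/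
structure PRiemannSurface (P : Type u) [CommRing P] [Algebra ℝ P]
    (M : Type v) [TopologicalSpace M] [ChartedSpace ℂ M] [IsManifold 𝓘(ℂ) ω M] where
  /-- The structure presheaf. -/
  presheaf : TopCat.Presheaf (CommAlgCat.{max u v} (Complexification P)) (TopCat.of M)
  /-- The structure presheaf is a sheaf. -/
  isSheaf : TopCat.Presheaf.IsSheaf
    (presheaf ⋙ forget (CommAlgCat.{max u v} (Complexification P)))
  /-- Around every point there are an open `U` and an isomorphism of sheaves of `𝒫^ℂ`-algebras
  between the restrictions to `U` of the structure sheaf and of `𝒪_M ⊗ 𝒫^ℂ`. -/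
  locally_iso : ∀ x : M, ∃ U : Opens M, x ∈ U ∧
    ∃ e : ∀ V : Opens M, V ≤ U →
        (presheaf.obj (op V) ≃ₐ[Complexification P] PHolFun P V),
      ∀ (V W : Opens M) (hV : V ≤ U) (hWV : W ≤ V) (s : presheaf.obj (op V)),
        e W (hWV.trans hV) (presheaf.map (homOfLE hWV).op s) =
          PHolFun.restrict P hWV (e V hV s)

section Morphisms

/-- The preimage of an open set under a holomorphic map. -/
noncomputable def holPreimage {M : Type v} [TopologicalSpace M] [ChartedSpace ℂ M]
    {N : Type w} [TopologicalSpace N] [ChartedSpace ℂ N] (φ : C^ω⟮𝓘(ℂ), M; 𝓘(ℂ), N⟯) (V : Opens N) : Opens M :=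
  ⟨φ ⁻¹' V, V.isOpen.preimage φ.contMDiff.continuous⟩

theorem holPreimage_mono {M : Type v} [TopologicalSpace M] [ChartedSpace ℂ M]
    {N : Type w} [TopologicalSpace N] [ChartedSpace ℂ N] (φ : C^ω⟮𝓘(ℂ), M; 𝓘(ℂ), N⟯) {W V : Opens N} (h : W ≤ V) :
    holPreimage φ W ≤ holPreimage φ V := fun _ hx => h hx

variable {P : Type u} [CommRing P] [Algebra ℝ P]
variable {M : Type v} [TopologicalSpace M] [ChartedSpace ℂ M] [IsManifold 𝓘(ℂ) ω M]
variable {N : Type w} [TopologicalSpace N] [ChartedSpace ℂ N] [IsManifold 𝓘(ℂ) ω N]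
variable {L : Type*} [TopologicalSpace L] [ChartedSpace ℂ L] [IsManifold 𝓘(ℂ) ω L]

/-- The `𝒫^ℂ`-algebra of sections over an open set. -/
abbrev PRiemannSurface.sections (X : PRiemannSurface P M) (U : Opens M) : Type (max u v) :=
  X.presheaf.obj (op U)

/-- Restriction of sections. -/
noncomputable abbrev PRiemannSurface.res (X : PRiemannSurface P M) {U V : Opens M} (h : U ≤ V) :
    X.sections V →ₐ[Complexification P] X.sections U :=
  (X.presheaf.map (homOfLE h).op).hom

/-- A `𝒫`-morphism `(M, 𝒮) → (N, 𝒯)`: a holomorphic map `φ : M → N` (the body) together with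
`𝒫^ℂ`-algebra homomorphisms `𝒯(V) → 𝒮(φ⁻¹ V)` commuting with restrictions. -/
@[ext] structure PMorphism (X : PRiemannSurface P M) (Y : PRiemannSurface P N) where
  /-- The body of the morphism. -/
  body : C^ω⟮𝓘(ℂ), M; 𝓘(ℂ), N⟯
  /-- The pullback of sections. -/
  pullback : ∀ V : Opens N,
    Y.sections V →ₐ[Complexification P] X.sections (holPreimage body V)
  /-- Pullback commutes with restriction. -/
  pullback_res : ∀ (V W : Opens N) (h : W ≤ V) (s : Y.sections V),
    pullback W (Y.res h s) = X.res (holPreimage_mono body h) (pullback V s)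

namespace PMorphism

/-- The identity `𝒫`-morphism. -/
noncomputable def id (X : PRiemannSurface P M) : PMorphism X X where
  body := ContMDiffMap.id
  pullback V := AlgHom.id _ (X.sections V)
  pullback_res _ _ _ _ := rfl

/-- Composition of `𝒫`-morphisms. -/
noncomputable def comp {X : PRiemannSurface P M} {Y : PRiemannSurface P N} {Z : PRiemannSurface P L}
    (Ψ : PMorphism Y Z) (Φ : PMorphism X Y) : PMorphism X Z where
  body := Ψ.body.comp Φ.body
  pullback V := (Φ.pullback (holPreimage Ψ.body V)).comp (Ψ.pullback V)
  pullback_res V W h s := by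
    change Φ.pullback _ (Ψ.pullback W _) = X.res _ (Φ.pullback _ (Ψ.pullback V s))
    rw [Ψ.pullback_res V W h s, Φ.pullback_res]

/-- A `𝒫`-morphism is a `𝒫`-isomorphism if it has a two-sided inverse `𝒫`-morphism. -/
def IsIso {X : PRiemannSurface P M} {Y : PRiemannSurface P N} (Φ : PMorphism X Y) : Prop :=
  ∃ Ψ : PMorphism Y X, Ψ.comp Φ = PMorphism.id X ∧ Φ.comp Ψ = PMorphism.id Y

end PMorphism

/-- A one-dimensional complex manifold `M` regarded as the `𝒫`-Riemann surface
`(M, 𝒪_M ⊗ 𝒫^ℂ)`. -/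
noncomputable def PRiemannSurface.ofManifold (P : Type u) [CommRing P] [Algebra ℝ P]
    [Module.Finite ℝ P] (M : Type v) [TopologicalSpace M] [ChartedSpace ℂ M]
    [IsManifold 𝓘(ℂ) ω M] : PRiemannSurface P M where
  presheaf := pHolPresheaf M P
  isSheaf := pHolPresheaf_isSheaf M P
  locally_iso _ := ⟨⊤, trivial, fun _ _ => AlgEquiv.refl, fun _ _ _ _ _ => rfl⟩

end Morphisms

/-! Put A = 𝒫^ℂ. The body map induces an augmentation ε : A → ℂ with nilpotent kernel I. Any two
local trivializations of the structure sheaf agree modulo I: a section s has body c at a point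
exactly when s - c is invertible in no neighbourhood of it, and invertibility does not depend on a
trivialization (`Trivialization.agreeMod_ker`). Suppose the trivializations e_i agree modulo J =
I^(k+1), and let J' = I^(k+2). By Taylor expansion, an automorphism g of A ⊗ 𝒪 that is trivial
modulo J equals 1 + a·d/dz modulo J², where a = g(z) - z has values in J
(`AlgHolFun.eval_sub_sub_mem`). The displacements a_ij of the transition maps form an additive
cocycle modulo J² (`AgreeMod.shift_cocycle`). The obstruction to agreement modulo J' thus lies in
H¹(ℙ¹, T) ⊗ J/J', which vanishes: write a_ij = a_i - a_j modulo J' (`exists_splitting`) and replace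
e_i by exp(-a_i·d/dz) ∘ e_i. After finitely many rounds the ideal is zero, so the trivializations
agree and glue to an isomorphism. The vanishing is obtained by hand. With w = 1/z one has d/dz =
-w²·d/dw, so d/dz is a vector field on all of ℙ¹. The cover is chosen with a single member
containing ∞, so that overlaps of distinct members lie in ℂ and the splitting is an additive Cousin
problem on ℂ. A partition of unity reduces it to a ∂̄-equation with compactly supported right-hand
side. The Cauchy transform solves this equation and tends to 0 at infinity, so the solution on the
special member extends holomorphically over ∞. -/

section DolbeaultLemma

open MeasureTheory Filter Topology Complex

/-! ### The inhomogeneous Cauchy–Riemann equation on ℂ. -/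

/-- Twice the Wirtinger derivative `∂f/∂z̄`. -/
noncomputable def dbar (f : ℂ → ℂ) (z : ℂ) : ℂ :=
  fderiv ℝ f z 1 + I * fderiv ℝ f z I

theorem dbar_congr {f g : ℂ → ℂ} {z : ℂ} (h : f =ᶠ[𝓝 z] g) : dbar f z = dbar g z := by
  simp only [dbar, h.fderiv_eq]

theorem dbar_sub {f g : ℂ → ℂ} {z : ℂ} (hf : DifferentiableAt ℝ f z)
    (hg : DifferentiableAt ℝ g z) : dbar (fun w => f w - g w) z = dbar f z - dbar g z := by
  simp only [dbar, fderiv_fun_sub hf hg, sub_apply]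
  ring

theorem dbar_eq_zero {f : ℂ → ℂ} {z : ℂ} (hf : DifferentiableAt ℂ f z) : dbar f z = 0 := by
  have h := (differentiableAt_complex_iff_differentiableAt_real.1 hf).2
  rw [dbar, h, smul_eq_mul, ← mul_assoc, I_mul_I]
  ring

theorem differentiableAt_of_dbar_eq_zero {f : ℂ → ℂ} {z : ℂ} (hf : DifferentiableAt ℝ f z)
    (h : dbar f z = 0) : DifferentiableAt ℂ f z := by
  refine differentiableAt_complex_iff_differentiableAt_real.2 ⟨hf, ?_⟩
  rw [dbar] at h
  rw [smul_eq_mul]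
  linear_combination (-I) * h + fderiv ℝ f z I * I_mul_I

theorem contDiffAt_dbar {f : ℂ → ℂ} {z : ℂ} (hf : ContDiffAt ℝ 2 f z) :
    ContDiffAt ℝ 1 (dbar f) z := by
  have h : ContDiffAt ℝ 1 (fderiv ℝ f) z := hf.fderiv_right (by norm_num)
  exact (h.clm_apply contDiffAt_const).add (contDiffAt_const.mul (h.clm_apply contDiffAt_const))

/-- This is e^(-iθ)(∂_x + i∂_y) = ∂_r + (i/r)∂_θ, with D playing the differential. It splits the
integrand of the Cauchy–Pompeiu formula into a radial and an angular derivative. -/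
theorem inv_mul_dbar_polar (D : ℂ →L[ℝ] ℂ) (θ : ℝ) :
    (exp (θ * I))⁻¹ * (D 1 + I * D I) = D (exp (θ * I)) + I * D (I * exp (θ * I)) := by
  have he : exp (θ * I) = Real.cos θ • (1 : ℂ) + Real.sin θ • I := by
    simp [exp_mul_I]
  have he' : I * exp (θ * I) = Real.cos θ • I - Real.sin θ • (1 : ℂ) := by
    rw [he]; simp only [real_smul]; linear_combination (Real.sin θ : ℂ) * I_mul_I
  have hi : (exp (θ * I))⁻¹ = Real.cos θ - Real.sin θ * I := by
    rw [← exp_neg, ← neg_mul, ← ofReal_neg, exp_mul_I]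
    simp
    ring
  rw [hi, he', he]
  simp only [map_add, map_sub, map_smul]
  simp only [real_smul]
  linear_combination (-(Real.sin θ) * D I : ℂ) * I_mul_I

theorem HasCompactSupport.exists_radius {E F : Type*} [NormedAddCommGroup E]
    [NormedAddCommGroup F] {g : E → F} (hg : HasCompactSupport g) :
    ∃ R : ℝ, 0 < R ∧ ∀ z, R < ‖z‖ → z ∉ tsupport g := by
  obtain ⟨R, hR, h⟩ := hg.isCompact.isBounded.exists_pos_norm_le
  exact ⟨R, hR, fun z hz hz' => absurd (h z hz') (not_le.2 hz)⟩

/-- The Cauchy–Pompeiu formula for compactly supported functions. -/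
theorem integral_inv_mul_dbar {G : ℂ → ℂ} (hG : ContDiff ℝ 1 G) (hc : HasCompactSupport G) :
    ∫ z : ℂ, z⁻¹ * dbar G z = -(2 * Real.pi * G 0) := by
  obtain ⟨R, hR, hsupp⟩ := hc.exists_radius
  have hcD : Continuous (fderiv ℝ G) := hG.continuous_fderiv one_ne_zero
  set e : ℝ → ℂ := fun θ => exp (θ * I) with he
  have hecont : Continuous e := by fun_prop
  have hnorm : ∀ r θ : ℝ, ‖(r : ℂ) * e θ‖ = |r| := fun r θ => by
    simp [he, norm_exp_ofReal_mul_I]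
  have hd0 : ∀ r θ : ℝ, R < r → fderiv ℝ G (r * e θ) = 0 := fun r θ hr =>
    image_eq_zero_of_notMem_tsupport fun h =>
      hsupp _ (by rw [hnorm]; exact hr.trans_le (le_abs_self r)) (tsupport_fderiv_subset ℝ h)
  have hG0 : ∀ r θ : ℝ, R < r → G (r * e θ) = 0 := fun r θ hr =>
    image_eq_zero_of_notMem_tsupport
      (hsupp _ (by rw [hnorm]; exact hr.trans_le (le_abs_self r)))
  let F₁ : ℝ × ℝ → ℂ := fun p => fderiv ℝ G (p.1 * e p.2) (e p.2)
  let F₂ : ℝ × ℝ → ℂ := fun p => fderiv ℝ G (p.1 * e p.2) (I * e p.2)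
  have hFint : ∀ v : ℝ → ℂ, Continuous v →
      IntegrableOn (fun p : ℝ × ℝ => fderiv ℝ G (p.1 * e p.2) (v p.2))
        (Set.Ioi (0 : ℝ) ×ˢ Set.Ioo (-Real.pi) Real.pi) (volume.prod volume) := by
    intro v hv
    have hcont : Continuous (fun p : ℝ × ℝ => fderiv ℝ G (p.1 * e p.2) (v p.2)) := by fun_prop
    have hK : IntegrableOn (fun p : ℝ × ℝ => fderiv ℝ G (p.1 * e p.2) (v p.2))
        (Set.Icc (0 : ℝ) R ×ˢ Set.Icc (-Real.pi) Real.pi) (volume.prod volume) :=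
      hcont.continuousOn.integrableOn_compact (isCompact_Icc.prod isCompact_Icc)
    refine hK.of_forall_sdiff_eq_zero (measurableSet_Ioi.prod measurableSet_Ioo) ?_
    rintro ⟨r, θ⟩ ⟨⟨hr, hθ⟩, hn⟩
    have : R < r := by
      by_contra hle
      exact hn ⟨⟨(Set.mem_Ioi.1 hr).le, not_lt.1 hle⟩, ⟨hθ.1.le, hθ.2.le⟩⟩
    simp [hd0 r θ this]
  have hF₁ : IntegrableOn F₁ _ _ := hFint e hecont
  have hF₂ : IntegrableOn F₂ _ _ := hFint (fun θ => I * e θ) (by fun_prop)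
  have hderiv₁ : ∀ r θ : ℝ, HasDerivAt (fun r : ℝ => G (r * e θ)) (F₁ (r, θ)) r := fun r θ => by
    have h1 : HasDerivAt (fun r : ℝ => (r : ℂ) * e θ) (e θ) r := by
      simpa using (ofRealCLM.hasDerivAt (x := r)).mul_const (e θ)
    exact (hG.differentiable one_ne_zero _).hasFDerivAt.comp_hasDerivAt r h1
  have hderiv₂ : ∀ r θ : ℝ, HasDerivAt (fun θ : ℝ => G (r * e θ)) (r * F₂ (r, θ)) θ := fun r θ => by
    have h1 : HasDerivAt (fun θ : ℝ => (r : ℂ) * e θ) (r * (I * e θ)) θ := by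
      have h0 : HasDerivAt (fun θ : ℝ => (θ : ℂ) * I) I θ := by
        simpa using (ofRealCLM.hasDerivAt (x := θ)).mul_const I
      have h2 := h0.cexp.const_mul (r : ℂ)
      rwa [mul_comm (exp _) I] at h2
    have h3 := (hG.differentiable one_ne_zero _).hasFDerivAt.comp_hasDerivAt θ h1
    have h4 : fderiv ℝ G (r * e θ) (r * (I * e θ)) = r * F₂ (r, θ) := by
      have h5 : (r : ℂ) * (I * e θ) = r • (I * e θ) := real_smul.symm
      rw [h5, map_smul, real_smul]
    rwa [h4] at h3
  -- The Jacobian r cancels the modulus of z⁻¹. What remains is `F₁`, the radial derivative of G,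
  -- and `F₂`, the angular derivative divided by r.
  have hpolar : ∫ z : ℂ, z⁻¹ * dbar G z = ∫ p in Set.Ioi (0 : ℝ) ×ˢ Set.Ioo (-Real.pi) Real.pi,
      (F₁ p + I * F₂ p) ∂(volume.prod volume) := by
    rw [← Complex.integral_comp_polarCoord_symm]
    refine setIntegral_congr_fun (measurableSet_Ioi.prod measurableSet_Ioo) ?_
    rintro ⟨r, θ⟩ ⟨hr, -⟩
    have hr' : (r : ℂ) ≠ 0 := ofReal_ne_zero.2 (ne_of_gt hr)
    have h1 : Complex.polarCoord.symm (r, θ) = r * e θ := by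
      simp [he, exp_mul_I]
    simp only [h1, F₁, F₂]
    rw [← inv_mul_dbar_polar (fderiv ℝ G (r * e θ)) θ, real_smul, mul_inv, dbar,
      mul_assoc, mul_inv_cancel_left₀ hr']
  -- Each ray contributes 0 - G(0), and the rays are parametrized by an interval of length 2π.
  have hI₁ : ∫ p in Set.Ioi (0 : ℝ) ×ˢ Set.Ioo (-Real.pi) Real.pi, F₁ p ∂(volume.prod volume)
      = -(2 * Real.pi * G 0) := by
    rw [← setIntegral_prod_swap]
    refine (setIntegral_prod _ hF₁.swap).trans ?_
    have hin : ∀ θ : ℝ, ∫ r in Set.Ioi (0 : ℝ), F₁ (r, θ) = - G 0 := by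
      intro θ
      have hint : IntegrableOn (fun r => F₁ (r, θ)) (Set.Ioi 0) := by
        have hcont : Continuous (fun r => F₁ (r, θ)) := by fun_prop
        have hK : IntegrableOn (fun r => F₁ (r, θ)) (Set.Icc 0 R) :=
          hcont.continuousOn.integrableOn_compact isCompact_Icc
        refine hK.of_forall_sdiff_eq_zero measurableSet_Ioi ?_
        rintro r ⟨hr, hn⟩
        have : R < r := by
          by_contra hle
          exact hn ⟨(Set.mem_Ioi.1 hr).le, not_lt.1 hle⟩
        simp [F₁, hd0 r θ this]
      have ht : Tendsto (fun r : ℝ => G (r * e θ)) atTop (𝓝 0) := by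
        refine tendsto_const_nhds.congr' ?_
        filter_upwards [eventually_gt_atTop R] with r hr
        exact (hG0 r θ hr).symm
      rw [integral_Ioi_of_hasDerivAt_of_tendsto' (fun r _ => hderiv₁ r θ) hint ht]
      simp
    have h2 : ∀ θ : ℝ, ∫ r in Set.Ioi (0 : ℝ), (F₁ ∘ Prod.swap) (θ, r) = - G 0 := hin
    simp only [h2]
    rw [setIntegral_const, real_smul, Real.volume_real_Ioo_of_le (by linarith [Real.pi_pos])]
    push_cast
    ring
  -- On each circle an angular derivative integrates to zero by periodicity.
  have hI₂ : ∫ p in Set.Ioi (0 : ℝ) ×ˢ Set.Ioo (-Real.pi) Real.pi, F₂ p ∂(volume.prod volume)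
      = 0 := by
    rw [setIntegral_prod _ hF₂]
    refine setIntegral_eq_zero_of_forall_eq_zero fun r hr => ?_
    have hr' : (r : ℂ) ≠ 0 := ofReal_ne_zero.2 (ne_of_gt hr)
    rw [← integral_Ioc_eq_integral_Ioo,
      ← intervalIntegral.integral_of_le (by linarith [Real.pi_pos])]
    have hcont : Continuous (fun θ => (r : ℂ) * F₂ (r, θ)) := by fun_prop
    have h := intervalIntegral.integral_eq_sub_of_hasDerivAt
      (fun θ _ => hderiv₂ r θ) (hcont.intervalIntegrable (-Real.pi) Real.pi)
    rw [intervalIntegral.integral_const_mul] at h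
    have hpi : e Real.pi = e (-Real.pi) := by
      simp [he, exp_neg]
    rw [hpi, sub_self] at h
    exact (mul_eq_zero.1 h).resolve_left hr'
  rw [hpolar, integral_add hF₁ (hF₂.const_mul I), integral_const_mul, hI₁, hI₂]
  simp

theorem locallyIntegrable_complex_inv : LocallyIntegrable (fun z : ℂ => z⁻¹) := by
  refine locallyIntegrable_of_norm_le_rpow (C := 1) (α := 1) (by simp) (by simp)
    (Eventually.of_forall fun z => ?_) (by fun_prop)
  rw [norm_inv, Real.rpow_neg_one, one_mul]

/-- Solution of the inhomogeneous Cauchy–Riemann equation with compactly supported right-hand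
side, vanishing at infinity. -/
theorem exists_dbar_eq {g : ℂ → ℂ} (hg : ContDiff ℝ 1 g) (hc : HasCompactSupport g) :
    ∃ u : ℂ → ℂ, Differentiable ℝ u ∧ (∀ z, dbar u z = g z) ∧
      Tendsto u (Bornology.cobounded ℂ) (𝓝 0) := by
  obtain ⟨R, hR, hsupp⟩ := hc.exists_radius
  let L : ℂ →L[ℝ] ℂ →L[ℝ] ℂ := ContinuousLinearMap.mul ℝ ℂ
  -- The Cauchy transform of g. Derivatives may be moved onto g, and Cauchy–Pompeiu applied to t ↦
  -- g(z - t) then gives dbar v = 2πg.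
  let v : ℂ → ℂ := convolution (fun z : ℂ => z⁻¹) g L volume
  have hv : ∀ z, HasFDerivAt v ((convolution (fun z : ℂ => z⁻¹) (fderiv ℝ g) (L.precompR ℂ)
      volume) z) z := fun z =>
    hc.hasFDerivAt_convolution_right L locallyIntegrable_complex_inv hg z
  have hvd : ∀ z, dbar v z = 2 * Real.pi * g z := by
    intro z
    have hcg : Continuous (fderiv ℝ g) := hg.continuous_fderiv one_ne_zero
    have hcs : HasCompactSupport (fderiv ℝ g) := hc.fderiv ℝ
    have hint : ∀ w : ℂ, Integrable (fun t : ℂ => t⁻¹ * fderiv ℝ g (z - t) w) := fun w =>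
      ((hcs.comp_left (g := fun T : ℂ →L[ℝ] ℂ => T w) (by simp)).convolutionExists_right L
        locallyIntegrable_complex_inv (by fun_prop)) z
    rw [dbar, (hv z).fderiv,
      convolution_precompR_apply L locallyIntegrable_complex_inv hcs hcg,
      convolution_precompR_apply L locallyIntegrable_complex_inv hcs hcg]
    simp only [convolution_def, L, ContinuousLinearMap.mul_apply']
    rw [← integral_const_mul, ← integral_add (hint 1) ((hint I).const_mul I)]
    have hG : ContDiff ℝ 1 (fun t => g (z - t)) := by fun_prop
    have hGc : HasCompactSupport (fun t => g (z - t)) :=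
      hc.comp_homeomorph (Homeomorph.subLeft z)
    have key := integral_inv_mul_dbar hG hGc
    have hfd : ∀ t w, fderiv ℝ (fun t => g (z - t)) t w = - fderiv ℝ g (z - t) w := by
      intro t w
      have h1 : HasFDerivAt (fun t : ℂ => z - t) (-ContinuousLinearMap.id ℝ ℂ) t := by
        simpa using (hasFDerivAt_id (𝕜 := ℝ) t).const_sub z
      have h2 := (hg.differentiable one_ne_zero (z - t)).hasFDerivAt.comp t h1
      have h3 : fderiv ℝ (fun t => g (z - t)) t = _ := h2.fderiv
      rw [h3]
      simp
    simp only [dbar, hfd, sub_zero] at key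
    rw [← neg_inj, ← key, ← integral_neg]
    congr 1
    ext t
    ring
  have hlim : Tendsto v (Bornology.cobounded ℂ) (𝓝 0) := by
    have hgi : Integrable g := hg.continuous.integrable_of_hasCompactSupport hc
    have hbd : ∀ z : ℂ, R < ‖z‖ → ‖v z‖ ≤ (‖z‖ - R)⁻¹ * ∫ t, ‖g t‖ := by
      intro z hz
      have h0 : 0 < ‖z‖ - R := sub_pos.2 hz
      simp only [v]
      -- After the swap the kernel is (z - t)⁻¹, and ‖z - t‖ ≥ ‖z‖ - R wherever g(t) ≠ 0.
      rw [convolution_eq_swap, ← integral_const_mul]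
      refine norm_integral_le_of_norm_le (hgi.norm.const_mul _) (Eventually.of_forall fun t => ?_)
      simp only [L, ContinuousLinearMap.mul_apply', norm_mul, norm_inv]
      by_cases ht : R < ‖t‖
      · simp [image_eq_zero_of_notMem_tsupport (hsupp t ht)]
      · gcongr
        have := norm_sub_norm_le z t
        linarith
    have h1 : Tendsto (fun z : ℂ => (‖z‖ - R)⁻¹ * ∫ t, ‖g t‖) (Bornology.cobounded ℂ) (𝓝 0) := by
      have h2 : Tendsto (fun z : ℂ => ‖z‖ - R) (Bornology.cobounded ℂ) atTop :=
        tendsto_atTop_add_const_right _ _ tendsto_norm_cobounded_atTop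
      simpa using h2.inv_tendsto_atTop.mul_const (∫ t, ‖g t‖)
    refine squeeze_zero_norm' ?_ h1
    filter_upwards [tendsto_norm_cobounded_atTop.eventually_gt_atTop R] with z hz
    exact hbd z hz
  have hpi : (2 * Real.pi : ℂ) ≠ 0 := by simp [Real.pi_ne_zero]
  refine ⟨fun z => (2 * Real.pi : ℂ)⁻¹ * v z, ?_, ?_, ?_⟩
  · exact fun z => (hv z).differentiableAt.const_mul _
  · intro z
    have h : fderiv ℝ (fun z => (2 * Real.pi : ℂ)⁻¹ * v z) z = (2 * Real.pi : ℂ)⁻¹ • fderiv ℝ v z :=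
      fderiv_const_mul (hv z).differentiableAt _
    have h' := hvd z
    simp only [dbar] at h' ⊢
    rw [h]
    simp only [smul_apply, smul_eq_mul]
    field_simp
    linear_combination h'
  · simpa using hlim.const_mul (2 * Real.pi : ℂ)⁻¹

end DolbeaultLemma

/-! ### The additive Cousin problem on ℂ. -/

section CousinProblem

open Filter Topology

/-- The additive Cousin problem on `ℂ`, with a solution vanishing at infinity. -/
theorem exists_cousin_solution {ι : Type*} (U : ι → Set ℂ) (hU : ∀ i, IsOpen (U i))
    (hcov : ∀ z, ∃ i, z ∈ U i) (i₀ : ι) (R : ℝ) (hR : ∀ z : ℂ, R < ‖z‖ → z ∈ U i₀)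
    (a : ι → ι → ℂ → ℂ) (ha : ∀ i j, DifferentiableOn ℂ (a i j) (U i ∩ U j))
    (hcoc : ∀ i j k z, z ∈ U i → z ∈ U j → z ∈ U k → a i k z = a i j z + a j k z) :
    ∃ b : ι → ℂ → ℂ, (∀ i, DifferentiableOn ℂ (b i) (U i)) ∧
      (∀ i j z, z ∈ U i → z ∈ U j → b i z - b j z = a i j z) ∧
      Tendsto (b i₀) (Bornology.cobounded ℂ) (𝓝 0) := by
  classical
  -- All members except `U i₀` are cut down to a ball, so that far out only the `i₀` term of the
  -- partition of unity survives.
  let V : ι → Set ℂ := fun i => if i = i₀ then U i₀ else U i ∩ Metric.ball 0 (R + 1)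
  have hVU : ∀ i, V i ⊆ U i := by
    intro i z hz
    by_cases hi : i = i₀
    · subst hi; simpa [V] using hz
    · simp only [V, if_neg hi] at hz; exact hz.1
  have hV : ∀ i, IsOpen (V i) := by
    intro i
    simp only [V]
    split_ifs
    exacts [hU _, (hU i).inter Metric.isOpen_ball]
  have hVcov : (Set.univ : Set ℂ) ⊆ ⋃ i, V i := by
    intro z _
    rw [Set.mem_iUnion]
    by_cases hz : R < ‖z‖
    · exact ⟨i₀, by simpa [V] using hR z hz⟩
    · obtain ⟨i, hi⟩ := hcov z
      by_cases h : i = i₀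
      · subst h; exact ⟨i, by simpa [V] using hi⟩
      · exact ⟨i, by simp only [V, if_neg h]; exact ⟨hi, by rw [mem_ball_zero_iff]; linarith⟩⟩
  obtain ⟨ρ, hρ⟩ := SmoothPartitionOfUnity.exists_isSubordinate (modelWithCornersSelf ℝ ℂ)
    isClosed_univ V hV hVcov
  have hmem : ∀ k z, ρ k z ≠ 0 → z ∈ V k := fun k z h => hρ k (subset_tsupport _ h)
  have hfin : ∀ (z : ℂ) (f : ι → ℂ), (Function.support fun k => ρ k z • f k).Finite := fun z f =>
    (ρ.locallyFinite.point_finite z).subset fun k hk => by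
      simp only [Function.mem_support] at hk
      exact fun h => hk (by rw [h, zero_smul])
  -- A smooth splitting of the cocycle. The differences h_i - h_j are holomorphic, so the functions
  -- dbar h_i glue to a global g, and subtracting a solution u of dbar u = g makes every h_i
  -- holomorphic.
  let h : ι → ℂ → ℂ := fun i z => ∑ᶠ k, ρ k z • a i k z
  have hdiffAt : ∀ i j z, z ∈ U i → z ∈ U j → DifferentiableAt ℂ (a i j) z := fun i j z hi hj =>
    (ha i j).differentiableAt (((hU i).inter (hU j)).mem_nhds ⟨hi, hj⟩)
  have hsmooth : ∀ i z, z ∈ U i → ContDiffAt ℝ 2 (h i) z := by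
    intro i z hz
    refine ρ.contDiffAt_finsum fun k hk => ?_
    have hzk : z ∈ U k := hVU k (hρ k hk)
    exact (((ha i k).analyticAt (((hU i).inter (hU k)).mem_nhds ⟨hz, hzk⟩)).contDiffAt).restrict_scalars ℝ
  have hsub : ∀ i j z, z ∈ U i → z ∈ U j → h i z - h j z = a i j z := by
    intro i j z hi hj
    have h1 : ∀ k, ρ k z • a i k z - ρ k z • a j k z = ρ k z • a i j z := by
      intro k
      by_cases hk : ρ k z = 0
      · simp [hk]
      · rw [hcoc i j k z hi hj (hVU k (hmem k z hk)), smul_add, add_sub_cancel_right]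
    calc h i z - h j z = ∑ᶠ k, (ρ k z • a i k z - ρ k z • a j k z) :=
          (finsum_sub_distrib (hfin z _) (hfin z _)).symm
      _ = ∑ᶠ k, ρ k z • a i j z := by simp only [h1]
      _ = (∑ᶠ k, ρ k z) • a i j z := (finsum_smul _ _).symm
      _ = a i j z := by rw [ρ.sum_eq_one (Set.mem_univ z), one_smul]
  choose idx hidx using hcov
  let g : ℂ → ℂ := fun z => dbar (h (idx z)) z
  have hg : ∀ i z, z ∈ U i → g z = dbar (h i) z := by
    intro i z hz
    have h1 : dbar (fun w => h (idx z) w - h i w) z = 0 := by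
      rw [dbar_congr (g := a (idx z) i)]
      · exact dbar_eq_zero (hdiffAt _ _ z (hidx z) hz)
      · filter_upwards [(hU _).mem_nhds (hidx z), (hU _).mem_nhds hz] with w h1 h2
        exact hsub _ _ w h1 h2
    rw [dbar_sub ((hsmooth _ z (hidx z)).differentiableAt (by norm_num))
      ((hsmooth _ z hz).differentiableAt (by norm_num))] at h1
    exact sub_eq_zero.1 h1
  have hgsmooth : ContDiff ℝ 1 g := by
    rw [contDiff_iff_contDiffAt]
    intro z
    refine (contDiffAt_dbar (hsmooth _ z (hidx z))).congr_of_eventuallyEq ?_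
    filter_upwards [(hU _).mem_nhds (hidx z)] with w hw
    exact hg _ w hw
  -- Outside the ball only a_(i₀i₀) contributes, and it vanishes by the cocycle identity. This gives
  -- g compact support and b_(i₀) = -u near infinity.
  have hzero : ∀ z : ℂ, R + 1 < ‖z‖ → h i₀ z = 0 := by
    intro w hw'
    have hw0 : w ∈ U i₀ := hR w (by linarith)
    refine finsum_eq_zero_of_forall_eq_zero fun k => ?_
    by_cases hk : k = i₀
    · have h0 := hcoc i₀ i₀ i₀ w hw0 hw0 hw0
      rw [hk, left_eq_add.1 h0, smul_zero]
    · have : ρ k w = 0 := by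
        by_contra hne
        have h2 := hmem k w hne
        simp only [V, if_neg hk] at h2
        have h3 := mem_ball_zero_iff.1 h2.2
        linarith
      rw [this, zero_smul]
  have hgc : HasCompactSupport g := by
    refine HasCompactSupport.intro (isCompact_closedBall (0 : ℂ) (R + 1)) fun z hz => ?_
    have hz' : R + 1 < ‖z‖ := by simpa using hz
    rw [hg i₀ z (hR z (by linarith)), dbar_congr (g := fun _ => 0)]
    · exact dbar_eq_zero (differentiableAt_const _)
    · filter_upwards [(isOpen_lt continuous_const continuous_norm).mem_nhds hz'] with w hw
      exact hzero w hw
  obtain ⟨u, hud, hu, hlim⟩ := exists_dbar_eq hgsmooth hgc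
  refine ⟨fun i z => h i z - u z, ?_, ?_, ?_⟩
  · intro i z hz
    have hhd := (hsmooth i z hz).differentiableAt (by norm_num)
    refine (differentiableAt_of_dbar_eq_zero (hhd.sub (hud z)) ?_).differentiableWithinAt
    have := dbar_sub hhd (hud z)
    rw [hu z, hg i z hz, sub_self] at this
    exact this
  · intro i j z hi hj
    rw [← hsub i j z hi hj]
    ring
  · have h1 : Tendsto (fun z => - u z) (Bornology.cobounded ℂ) (𝓝 0) := by simpa using hlim.neg
    refine h1.congr' ?_
    filter_upwards [tendsto_norm_cobounded_atTop.eventually_gt_atTop (R + 1)] with z hz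
    rw [hzero z hz, zero_sub]

end CousinProblem

/-! ### Holomorphy on ℙ¹ read in the charts z and 1/z. -/

namespace RiemannSphere

open Filter Topology

theorem affineChart_mem_maximalAtlas :
    affineChart ∈ IsManifold.maximalAtlas 𝓘(ℂ) ω RiemannSphere :=
  IsManifold.subset_maximalAtlas (Set.mem_insert _ _)

theorem inftyChart_mem_maximalAtlas :
    inftyChart ∈ IsManifold.maximalAtlas 𝓘(ℂ) ω RiemannSphere :=
  IsManifold.subset_maximalAtlas (Set.mem_insert_of_mem _ rfl)

theorem contMDiffAt_iff_analyticAt_comp_chart_symm {e : OpenPartialHomeomorph RiemannSphere ℂ}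
    (he : e ∈ IsManifold.maximalAtlas 𝓘(ℂ) ω RiemannSphere) {F : RiemannSphere → ℂ}
    {x : RiemannSphere} (hx : x ∈ e.source) :
    ContMDiffAt 𝓘(ℂ) 𝓘(ℂ) ω F x ↔ AnalyticAt ℂ (fun w : ℂ => F (e.symm w)) (e x) := by
  rw [← analyticWithinAt_univ, ← contDiffWithinAt_omega_iff_analyticWithinAt, contDiffWithinAt_univ, ← contMDiffAt_iff_contDiffAt]
  constructor
  · intro h
    have h1 : ContMDiffAt 𝓘(ℂ) 𝓘(ℂ) ω e.symm (e x) :=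
      (contMDiffOn_symm_of_mem_maximalAtlas he).contMDiffAt
        (e.open_target.mem_nhds (e.map_source hx))
    rw [← e.left_inv hx] at h
    exact h.comp (e x) h1
  · intro h
    have h1 : ContMDiffAt 𝓘(ℂ) 𝓘(ℂ) ω e x :=
      (contMDiffOn_of_mem_maximalAtlas he).contMDiffAt (e.open_source.mem_nhds hx)
    refine (h.comp x h1).congr_of_eventuallyEq ?_
    filter_upwards [e.open_source.mem_nhds hx] with y hy
    simp [e.left_inv hy]

theorem contMDiffAt_coe_iff {F : RiemannSphere → ℂ} {z : ℂ} :
    ContMDiffAt 𝓘(ℂ) 𝓘(ℂ) ω F (z : RiemannSphere) ↔ AnalyticAt ℂ (fun w : ℂ => F w) z := by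
  rw [contMDiffAt_iff_analyticAt_comp_chart_symm affineChart_mem_maximalAtlas
    (mem_affineChart_source.2 (OnePoint.coe_ne_infty z))]
  simp

theorem contMDiffAt_infty_iff {F : RiemannSphere → ℂ} :
    ContMDiffAt 𝓘(ℂ) 𝓘(ℂ) ω F OnePoint.infty ↔
      AnalyticAt ℂ (fun w : ℂ => F (inversion w)) 0 := by
  rw [contMDiffAt_iff_analyticAt_comp_chart_symm inftyChart_mem_maximalAtlas
    (mem_inftyChart_source.2 (OnePoint.infty_ne_coe 0))]
  simp [inftyChart_apply, inftyChart_symm_apply]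

end RiemannSphere

/-! ### The derivation d/dz, Taylor expansion and extension over ∞. -/

namespace HolFun

open RiemannSphere Filter Topology

variable {V W : Opens RiemannSphere}

/-- The holomorphic function on `V` given by a function that is holomorphic at each point. -/
noncomputable def ofFun (F : RiemannSphere → ℂ) (hF : ∀ x ∈ V, ContMDiffAt 𝓘(ℂ) 𝓘(ℂ) ω F x) :
    HolFun V :=
  ⟨fun x => F x, fun x => contMDiffAt_subtype_iff.2 (hF x.1 x.2)⟩

open Classical in
/-- Extension by zero. -/
noncomputable def extend (f : HolFun V) (x : RiemannSphere) : ℂ :=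
  if h : x ∈ V then f ⟨x, h⟩ else 0

theorem extend_of_mem (f : HolFun V) {x : RiemannSphere} (h : x ∈ V) : f.extend x = f ⟨x, h⟩ :=
  dif_pos h

theorem contMDiffAt_extend (f : HolFun V) {x : RiemannSphere} (hx : x ∈ V) :
    ContMDiffAt 𝓘(ℂ) 𝓘(ℂ) ω f.extend x := by
  have h : ContMDiffAt 𝓘(ℂ) 𝓘(ℂ) ω (fun y : V => f.extend y) ⟨x, hx⟩ := by
    have e : (fun y : V => f.extend y) = f := funext fun y => extend_of_mem f y.2
    rw [e]; exact f.contMDiff _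
  exact contMDiffAt_subtype_iff.1 h

theorem extend_add (f g : HolFun V) (x : RiemannSphere) :
    (f + g).extend x = f.extend x + g.extend x := by
  by_cases h : x ∈ V <;> simp [extend, h]

theorem extend_mul (f g : HolFun V) (x : RiemannSphere) :
    (f * g).extend x = f.extend x * g.extend x := by
  by_cases h : x ∈ V <;> simp [extend, h]

theorem extend_smul (c : ℂ) (f : HolFun V) (x : RiemannSphere) :
    (c • f).extend x = c * f.extend x := by
  by_cases h : x ∈ V <;> simp [extend, h]

theorem extend_restrict (h : W ≤ V) (f : HolFun V) {x : RiemannSphere} (hx : x ∈ W) :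
    (restrict h f).extend x = f.extend x := by
  rw [extend_of_mem _ hx, extend_of_mem _ (h hx), restrict_apply]

theorem isOpen_coe_preimage (V : Opens RiemannSphere) : IsOpen {z : ℂ | (z : RiemannSphere) ∈ V} :=
  V.isOpen.preimage OnePoint.continuous_coe

theorem eventually_coe_mem {z : ℂ} (hz : (z : RiemannSphere) ∈ V) :
    ∀ᶠ w : ℂ in 𝓝 z, (w : RiemannSphere) ∈ V :=
  (isOpen_coe_preimage V).mem_nhds hz

theorem eventually_inversion_mem (h : OnePoint.infty ∈ V) :
    ∀ᶠ w : ℂ in 𝓝 0, inversion (w : RiemannSphere) ∈ V := by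
  have hc : Continuous fun w : ℂ => inversion (w : RiemannSphere) :=
    continuous_inversion.comp OnePoint.continuous_coe
  exact (V.isOpen.preimage hc).mem_nhds (by simpa using h)

theorem analyticAt_extend (f : HolFun V) {z : ℂ} (hz : (z : RiemannSphere) ∈ V) :
    AnalyticAt ℂ (fun w : ℂ => f.extend w) z :=
  contMDiffAt_coe_iff.1 (f.contMDiffAt_extend hz)

/-- The derivative `df/dz`, extended by `0` to infinity. -/
noncomputable def derivFun (f : HolFun V) (x : RiemannSphere) : ℂ :=
  OnePoint.elim x 0 fun z : ℂ => deriv (fun w : ℂ => f.extend w) z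

@[simp] theorem derivFun_coe (f : HolFun V) (z : ℂ) :
    f.derivFun z = deriv (fun w : ℂ => f.extend w) z := rfl

@[simp] theorem derivFun_infty (f : HolFun V) : f.derivFun OnePoint.infty = 0 := rfl

/-- In the coordinate w = 1/z at infinity, d/dz becomes -w²·d/dw. Hence df/dz is holomorphic at ∞
with value 0, which is the value chosen in `derivFun`. -/
theorem contMDiffAt_derivFun (f : HolFun V) {x : RiemannSphere} (hx : x ∈ V) :
    ContMDiffAt 𝓘(ℂ) 𝓘(ℂ) ω f.derivFun x := by
  induction x using OnePoint.rec with
  | coe z =>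
    rw [contMDiffAt_coe_iff]
    exact (f.analyticAt_extend hx).deriv
  | infty =>
    rw [contMDiffAt_infty_iff]
    let H : ℂ → ℂ := fun w => f.extend (inversion w)
    have hH : AnalyticAt ℂ H 0 := contMDiffAt_infty_iff.1 (f.contMDiffAt_extend hx)
    have h1 : AnalyticAt ℂ (fun w : ℂ => -w ^ 2 * deriv H w) 0 :=
      ((analyticAt_id.pow 2).neg).mul hH.deriv
    refine h1.congr ?_
    filter_upwards [hH.eventually_analyticAt] with w hw
    by_cases h0 : w = 0
    · subst h0; simp
    · rw [inversion_coe h0, derivFun_coe]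
      have h2 : (fun u : ℂ => f.extend u) =ᶠ[𝓝 w⁻¹] fun u => H u⁻¹ := by
        filter_upwards [isOpen_ne.mem_nhds (inv_ne_zero h0)] with u hu
        simp only [H]
        rw [inversion_coe (inv_ne_zero hu), inv_inv]
      have h3 : HasDerivAt (fun u => H u⁻¹) (deriv H w * (-(w⁻¹ ^ 2)⁻¹)) w⁻¹ := by
        have h4 : HasDerivAt H (deriv H w) (w⁻¹)⁻¹ := by
          rw [inv_inv]; exact hw.differentiableAt.hasDerivAt
        exact h4.comp w⁻¹ (hasDerivAt_inv (inv_ne_zero h0))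
      rw [h2.deriv_eq, h3.deriv]
      field_simp

/-- The derivation `d/dz` of holomorphic functions on an open subset of `ℙ¹`. -/
noncomputable def derivation (V : Opens RiemannSphere) : HolFun V →ₗ[ℂ] HolFun V where
  toFun f := ofFun f.derivFun fun _ hx => f.contMDiffAt_derivFun hx
  map_add' f g := by
    ext ⟨x, hx⟩
    change (f + g).derivFun x = f.derivFun x + g.derivFun x
    induction x using OnePoint.rec with
    | infty => simp
    | coe z =>
      simp only [derivFun_coe, extend_add]
      exact deriv_fun_add (f.analyticAt_extend hx).differentiableAt
        (g.analyticAt_extend hx).differentiableAt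
  map_smul' c f := by
    ext ⟨x, hx⟩
    change (c • f).derivFun x = c * f.derivFun x
    induction x using OnePoint.rec with
    | infty => simp
    | coe z =>
      simp only [derivFun_coe, extend_smul]
      exact deriv_const_mul c (f.analyticAt_extend hx).differentiableAt

theorem derivation_apply (f : HolFun V) (x : V) : derivation V f x = f.derivFun x := rfl

theorem derivation_mul (f g : HolFun V) :
    derivation V (f * g) = f * derivation V g + derivation V f * g := by
  ext ⟨x, hx⟩
  change (f * g).derivFun x = f ⟨x, hx⟩ * g.derivFun x + f.derivFun x * g ⟨x, hx⟩
  induction x using OnePoint.rec with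
  | infty => simp
  | coe z =>
    simp only [derivFun_coe, extend_mul]
    rw [deriv_fun_mul (f.analyticAt_extend hx).differentiableAt
      (g.analyticAt_extend hx).differentiableAt, extend_of_mem f hx, extend_of_mem g hx]
    ring

theorem derivation_restrict (h : W ≤ V) (f : HolFun V) :
    derivation W (restrict h f) = restrict h (derivation V f) := by
  ext ⟨x, hx⟩
  change (restrict h f).derivFun x = f.derivFun x
  induction x using OnePoint.rec with
  | infty => simp
  | coe z =>
    refine Filter.EventuallyEq.deriv_eq ?_
    filter_upwards [eventually_coe_mem hx] with w hw
    exact extend_restrict h f hw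

/-- The coordinate function `z` on an open subset of `ℂ ⊆ ℙ¹`. -/
noncomputable def coord (hV : OnePoint.infty ∉ V) : HolFun V :=
  ofFun (fun x => OnePoint.elim x 0 fun z : ℂ => z) fun x hx => by
    induction x using OnePoint.rec with
    | infty => exact absurd hx hV
    | coe z => exact contMDiffAt_coe_iff.2 analyticAt_id

theorem coord_apply (hV : OnePoint.infty ∉ V) {z : ℂ} (hz : (z : RiemannSphere) ∈ V) :
    coord hV ⟨z, hz⟩ = z := rfl

theorem restrict_coord (hV : OnePoint.infty ∉ V) (h : W ≤ V) :
    restrict h (coord hV) = coord (fun hW => hV (h hW)) := rfl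

/-- First order Taylor expansion with holomorphic remainder. -/
theorem exists_taylor (hV : OnePoint.infty ∉ V) (f : HolFun V) {z : ℂ}
    (hz : (z : RiemannSphere) ∈ V) :
    ∃ h : HolFun V, f = algebraMap ℂ _ (f ⟨z, hz⟩) +
      derivation V f ⟨z, hz⟩ • (coord hV - algebraMap ℂ _ z) +
      (coord hV - algebraMap ℂ _ z) ^ 2 * h := by
  let F : ℂ → ℂ := fun w => f.extend w
  have hO := isOpen_coe_preimage V
  -- The remainder is the second iterated difference quotient at z; its singularity at z is
  -- removable.
  have hd : DifferentiableOn ℂ (dslope (dslope F z) z) {w : ℂ | (w : RiemannSphere) ∈ V} := by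
    rw [Complex.differentiableOn_dslope (hO.mem_nhds hz),
      Complex.differentiableOn_dslope (hO.mem_nhds hz)]
    exact fun w hw => (f.analyticAt_extend hw).differentiableAt.differentiableWithinAt
  refine ⟨ofFun (fun x => OnePoint.elim x 0 (dslope (dslope F z) z)) fun x hx => ?_, ?_⟩
  · induction x using OnePoint.rec with
    | infty => exact absurd hx hV
    | coe w => exact contMDiffAt_coe_iff.2 (hd.analyticAt (hO.mem_nhds hx))
  · ext ⟨x, hx⟩
    induction x using OnePoint.rec with
    | infty => exact absurd hx hV
    | coe w =>
      have h1 := sub_smul_dslope F z w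
      have h2 := sub_smul_dslope (dslope F z) z w
      rw [dslope_same] at h2
      have h3 : F w = f ⟨w, hx⟩ := extend_of_mem f hx
      have h4 : F z = f ⟨z, hz⟩ := extend_of_mem f hz
      rw [h3, h4] at h1
      change f ⟨w, hx⟩ = f ⟨z, hz⟩ + deriv F z * (w - z) +
        (w - z) ^ 2 * dslope (dslope F z) z w
      simp only [smul_eq_mul] at h1 h2
      linear_combination (-1 : ℂ) * h1 - (w - z) * h2

/-- The holomorphic function on `V` given by a function on `ℂ` vanishing at infinity. -/
theorem exists_eq_of_tendsto_zero (b : ℂ → ℂ)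
    (hb : DifferentiableOn ℂ b {z : ℂ | (z : RiemannSphere) ∈ V})
    (hinf : OnePoint.infty ∈ V → Tendsto b (Bornology.cobounded ℂ) (𝓝 0)) :
    ∃ f : HolFun V, ∀ (z : ℂ) (hz : (z : RiemannSphere) ∈ V), f ⟨z, hz⟩ = b z := by
  refine ⟨ofFun (fun x => OnePoint.elim x 0 b) fun x hx => ?_, fun z hz => rfl⟩
  induction x using OnePoint.rec with
  | coe z => exact contMDiffAt_coe_iff.2 (hb.analyticAt ((isOpen_coe_preimage V).mem_nhds hx))
  | infty =>
    rw [contMDiffAt_infty_iff]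
    set H : ℂ → ℂ := fun w => OnePoint.elim (inversion w) 0 b with hH
    have hne : ∀ w : ℂ, w ≠ 0 → H w = b w⁻¹ := fun w hw => by
      simp only [hH, inversion_coe hw]; rfl
    -- Removable singularity at w = 0: the value 0 at ∞ makes H continuous there because b tends to
    -- 0.
    refine Complex.analyticAt_of_differentiable_on_punctured_nhds_of_continuousAt ?_ ?_
    · filter_upwards [self_mem_nhdsWithin, (eventually_inversion_mem hx).filter_mono
        nhdsWithin_le_nhds] with w hw hwV
      have hw0 : w ≠ 0 := hw
      rw [inversion_coe hw0] at hwV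
      have h1 : DifferentiableAt ℂ (fun w => b w⁻¹) w :=
        (hb.differentiableAt ((isOpen_coe_preimage V).mem_nhds hwV)).comp w
          (differentiableAt_inv hw0)
      refine h1.congr_of_eventuallyEq ?_
      filter_upwards [isOpen_ne.mem_nhds hw0] with u hu
      exact hne u hu
    · rw [continuousAt_iff_punctured_nhds]
      have h0 : H 0 = 0 := by simp [hH]
      rw [h0]
      refine ((hinf hx).comp tendsto_inv₀_nhdsNE_zero).congr' ?_
      filter_upwards [self_mem_nhdsWithin] with w hw
      exact (hne w hw).symm

end HolFun

/-! ### Evaluation and invertibility of holomorphic functions. -/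

namespace HolFun

variable {V : Opens RiemannSphere}

/-- Evaluation of holomorphic functions at a point. -/
noncomputable def eval (x : V) : HolFun V →ₐ[ℂ] ℂ where
  toFun f := f x
  map_one' := rfl
  map_mul' _ _ := rfl
  map_zero' := rfl
  map_add' _ _ := rfl
  commutes' _ := rfl

theorem isUnit_of_forall_ne_zero (f : HolFun V) (hf : ∀ x, f x ≠ 0) : IsUnit f := by
  refine IsUnit.of_mul_eq_one (ofFun (fun x => (f.extend x)⁻¹) fun x hx => ?_) ?_
  · refine (f.contMDiffAt_extend hx).inv₀ ?_
    rw [extend_of_mem f hx]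
    exact hf _
  · ext x
    change f x * (f.extend x)⁻¹ = 1
    rw [extend_of_mem f x.2]
    exact mul_inv_cancel₀ (hf x)

theorem exists_restrict_ne_zero (f : HolFun V) (x : V) (hx : f x ≠ 0) :
    ∃ (W : Opens RiemannSphere) (h : W ≤ V), x.1 ∈ W ∧ ∀ y, restrict h f y ≠ 0 := by
  have h1 : ∀ᶠ y in nhds x.1, f.extend y ≠ 0 :=
    (f.contMDiffAt_extend x.2).continuousAt.eventually_ne (by rwa [extend_of_mem f x.2])
  obtain ⟨W, hW, hWo, hxW⟩ := eventually_nhds_iff.1 (h1.and (V.isOpen.mem_nhds x.2))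
  refine ⟨⟨W, hWo⟩, fun y hy => (hW y hy).2, hxW, fun y => ?_⟩
  have := (hW y.1 y.2).1
  rwa [extend_of_mem f (hW y.1 y.2).2] at this

end HolFun

/-- An A-linear map carries coefficients in J through unchanged. This is how A-linear differential
operators are seen to preserve, or raise, the J-adic order. -/
theorem Submodule.map_mem_smul_of_forall_mem {A M N : Type*} [CommRing A] [AddCommGroup M] [Module A M]
    [AddCommGroup N] [Module A N] (L : M →ₗ[A] N) {J : Ideal A} {K : Submodule A N}
    (hL : ∀ t, L t ∈ K) {s : M} (hs : s ∈ J • (⊤ : Submodule A M)) : L s ∈ J • K := by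
  have h1 : L s ∈ (J • (⊤ : Submodule A M)).map L := Submodule.mem_map_of_mem hs
  rw [Submodule.map_smul''] at h1
  refine Submodule.smul_mono le_rfl ?_ h1
  rintro _ ⟨t, -, rfl⟩
  exact hL t

/-! ### Sections of A ⊗ 𝒪: values, coefficients, bodies and units. -/

/-- The algebra `A ⊗ 𝒪(V)` of holomorphic functions with coefficients in `A`. -/
def AlgHolFun (A : Type u) [CommRing A] [Algebra ℂ A] (V : Opens RiemannSphere) : Type u :=
  A ⊗[ℂ] HolFun V

namespace AlgHolFun

variable {A : Type u} [CommRing A] [Algebra ℂ A] {V W : Opens RiemannSphere}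

noncomputable instance : CommRing (AlgHolFun A V) :=
  inferInstanceAs (CommRing (A ⊗[ℂ] HolFun V))

noncomputable instance : Algebra A (AlgHolFun A V) :=
  inferInstanceAs (Algebra A (A ⊗[ℂ] HolFun V))

noncomputable instance : Algebra ℂ (AlgHolFun A V) :=
  inferInstanceAs (Algebra ℂ (A ⊗[ℂ] HolFun V))

instance : IsScalarTower ℂ A (AlgHolFun A V) :=
  inferInstanceAs (IsScalarTower ℂ A (A ⊗[ℂ] HolFun V))

/-- Rational scalars carry the inverse factorials of `IsNilpotent.exp`. -/
noncomputable instance : Module ℚ (AlgHolFun A V) :=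
  Module.compHom _ (algebraMap ℚ ℂ)

/-- The section `c ⊗ f`. -/
noncomputable def tmul (c : A) (f : HolFun V) : AlgHolFun A V := c ⊗ₜ[ℂ] f

theorem induction_on {p : AlgHolFun A V → Prop} (s : AlgHolFun A V) (zero : p 0)
    (tmul : ∀ c f, p (tmul c f)) (add : ∀ s t, p s → p t → p (s + t)) : p s :=
  TensorProduct.induction_on (motive := p) s zero tmul add

theorem tmul_mul_tmul (c d : A) (f g : HolFun V) :
    tmul c f * tmul d g = tmul (c * d) (f * g) :=
  Algebra.TensorProduct.tmul_mul_tmul c d f g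

theorem smul_tmul (c d : A) (f : HolFun V) : c • tmul d f = tmul (c * d) f :=
  TensorProduct.smul_tmul' c d f

theorem tmul_add (c : A) (f g : HolFun V) : tmul c (f + g) = tmul c f + tmul c g :=
  TensorProduct.tmul_add c f g

variable (A) in
/-- Restriction `A ⊗ 𝒪(V) → A ⊗ 𝒪(W)`, for `W ⊆ V`. -/
noncomputable def restrict (h : W ≤ V) : AlgHolFun A V →ₐ[A] AlgHolFun A W :=
  (Algebra.TensorProduct.map (AlgHom.id A A) (HolFun.restrict h) :
    A ⊗[ℂ] HolFun V →ₐ[A] A ⊗[ℂ] HolFun W)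

theorem restrict_tmul (h : W ≤ V) (c : A) (f : HolFun V) :
    restrict A h (tmul c f) = tmul c (HolFun.restrict h f) := rfl

/-- The value in `A` of a section of `A ⊗ 𝒪` at a point. -/
noncomputable def eval (x : V) : AlgHolFun A V →ₐ[A] A :=
  (Algebra.TensorProduct.lift (AlgHom.id A A) ((Algebra.ofId ℂ A).comp (HolFun.eval x))
    fun _ _ => Commute.all _ _ : A ⊗[ℂ] HolFun V →ₐ[A] A)

theorem eval_tmul (x : V) (c : A) (f : HolFun V) : eval x (tmul c f) = f x • c := by
  change c * algebraMap ℂ A (f x) = f x • c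
  rw [Algebra.smul_def, mul_comm]

theorem eval_restrict (h : W ≤ V) (s : AlgHolFun A V) (x : W) :
    eval x (restrict A h s) = eval ⟨x.1, h x.2⟩ s := by
  induction s using induction_on with
  | zero => simp
  | tmul a f => rw [restrict_tmul, eval_tmul, eval_tmul]; rfl
  | add s t hs ht => simp only [map_add, hs, ht]

/-- The action of an endomorphism of `A` on the values of sections. -/
noncomputable def mapValue (T : A →ₗ[ℂ] A) : AlgHolFun A V →ₗ[ℂ] AlgHolFun A V :=
  (T.rTensor (HolFun V) : A ⊗[ℂ] HolFun V →ₗ[ℂ] A ⊗[ℂ] HolFun V)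

theorem mapValue_tmul (T : A →ₗ[ℂ] A) (c : A) (f : HolFun V) :
    mapValue T (tmul c f) = tmul (T c) f := rfl

theorem eval_mapValue (T : A →ₗ[ℂ] A) (s : AlgHolFun A V) (x : V) :
    eval x (mapValue T s) = T (eval x s) := by
  induction s using induction_on with
  | zero => simp
  | tmul a f => rw [mapValue_tmul, eval_tmul, eval_tmul, map_smul]
  | add s t hs ht => simp only [map_add, hs, ht]

section Coefficients

variable {ι : Type*} [DecidableEq ι] (b : Module.Basis ι ℂ A)

/-- The holomorphic coefficients of a section with respect to a basis of `A`. -/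
noncomputable def coeff (i : ι) (s : AlgHolFun A V) : HolFun V :=
  TensorProduct.equivFinsuppOfBasisLeft b (show A ⊗[ℂ] HolFun V from s) i

theorem coeff_tmul (i : ι) (c : A) (f : HolFun V) : coeff b i (tmul c f) = b.repr c i • f := by
  simp [coeff, tmul]

theorem coeff_zero (i : ι) : coeff b i (0 : AlgHolFun A V) = 0 := by
  change TensorProduct.equivFinsuppOfBasisLeft b (0 : A ⊗[ℂ] HolFun V) i = 0
  simp

theorem coeff_add (i : ι) (s t : AlgHolFun A V) :
    coeff b i (s + t) = coeff b i s + coeff b i t := by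
  change TensorProduct.equivFinsuppOfBasisLeft b
    ((show A ⊗[ℂ] HolFun V from s) + (show A ⊗[ℂ] HolFun V from t)) i = _
  rw [map_add]
  rfl

theorem coeff_apply (i : ι) (s : AlgHolFun A V) (x : V) :
    coeff b i s x = b.repr (eval x s) i := by
  induction s using induction_on with
  | zero => simp [coeff_zero]
  | tmul a f => rw [eval_tmul, coeff_tmul]; simp [mul_comm]
  | add s t hs ht => rw [coeff_add, ContMDiffMap.coe_add, Pi.add_apply, hs, ht]; simp

/-- The coefficients in a ℂ-basis of A are honest functions, so identities between sections can be
checked on their values in A. -/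
theorem ext_eval {s t : AlgHolFun A V} (h : ∀ x, eval x s = eval x t) : s = t := by
  classical
  let b := Module.Basis.ofVectorSpace ℂ A
  apply (TensorProduct.equivFinsuppOfBasisLeft (N := HolFun V) b).injective
  ext i x
  change coeff b i s x = coeff b i t x
  rw [coeff_apply, coeff_apply, h x]

end Coefficients

section Ideals

variable (J : Ideal A)

/-- Sections of `A ⊗ 𝒪` with values in the ideal `J` of `A` are `A`-linear combinations
with coefficients in `J`. -/
theorem mem_smul_top_iff {s : AlgHolFun A V} :
    s ∈ J • (⊤ : Submodule A (AlgHolFun A V)) ↔ ∀ x, eval x s ∈ J := by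
  constructor
  · intro hs x
    refine Submodule.smul_induction_on hs (fun c hc t _ => ?_) fun s t hs ht => ?_
    · rw [map_smul, smul_eq_mul]
      exact J.mul_mem_right _ hc
    · rw [map_add]; exact J.add_mem hs ht
  · intro h
    obtain ⟨q, hq⟩ := LinearMap.exists_leftInverse_of_injective
      (J.restrictScalars ℂ).subtype (Submodule.ker_subtype _)
    -- A ℂ-linear projection of A onto J. Applied to values it fixes s, and it turns every pure
    -- tensor into one with coefficient in J.
    let T : A →ₗ[ℂ] A := (J.restrictScalars ℂ).subtype ∘ₗ q
    have hT : ∀ c ∈ J, T c = c := fun c hc =>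
      congrArg Subtype.val (LinearMap.congr_fun hq (⟨c, hc⟩ : J.restrictScalars ℂ))
    have hs : mapValue T s = s := ext_eval fun x => by rw [eval_mapValue, hT _ (h x)]
    rw [← hs]
    clear hs h
    induction s using induction_on with
    | zero => simp
    | tmul a f =>
      have h1 : tmul (T a) f = T a • tmul (1 : A) f := by rw [smul_tmul, mul_one]
      rw [mapValue_tmul, h1]
      exact Submodule.smul_mem_smul (q a).2 trivial
    | add s t hs ht => rw [map_add]; exact add_mem hs ht

end Ideals

section Body

variable (ε : A →ₐ[ℂ] ℂ)

/-- The body of a section of `A ⊗ 𝒪`. -/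
noncomputable def body : AlgHolFun A V →ₗ[ℂ] HolFun V :=
  (Algebra.TensorProduct.lift ((Algebra.ofId ℂ (HolFun V)).comp ε) (AlgHom.id ℂ (HolFun V))
    fun _ _ => Commute.all _ _ : A ⊗[ℂ] HolFun V →ₐ[ℂ] HolFun V).toLinearMap

theorem body_apply (s : AlgHolFun A V) (x : V) : body ε s x = ε (eval x s) := by
  induction s using induction_on with
  | zero => simp
  | tmul a f =>
    rw [eval_tmul, map_smul, smul_eq_mul, mul_comm]
    rfl
  | add s t hs ht => simp only [map_add, ContMDiffMap.coe_add, Pi.add_apply, hs, ht]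

/-- The section differs from 1 ⊗ body by one with values in the nilpotent ideal ker ε, and a unit
plus a nilpotent is a unit. -/
theorem isUnit_of_body_ne_zero {n : ℕ} (hε : RingHom.ker ε ^ n = ⊥) (s : AlgHolFun A V)
    (hs : ∀ x, ε (eval x s) ≠ 0) : IsUnit s := by
  let t : AlgHolFun A V := tmul 1 (body ε s)
  have ht : IsUnit t := (HolFun.isUnit_of_forall_ne_zero (body ε s) fun x => by
    rw [body_apply]; exact hs x).map
      (Algebra.TensorProduct.includeRight : HolFun V →ₐ[ℂ] A ⊗[ℂ] HolFun V)
  have hnil : IsNilpotent (s - t) := by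
    refine ⟨n, ext_eval fun x => ?_⟩
    have h1 : eval x (s - t) ∈ RingHom.ker ε := by
      have h2 : eval x t = body ε s x • 1 := eval_tmul x 1 (body ε s)
      rw [RingHom.mem_ker, map_sub, h2, map_sub, map_smul, map_one, body_apply]
      simp
    have h3 := Ideal.pow_mem_pow h1 n
    rw [hε, Ideal.mem_bot] at h3
    rw [map_pow, h3, map_zero]
  have := hnil.isUnit_add_left_of_commute ht (Commute.all _ _)
  rwa [add_sub_cancel] at this

theorem exists_isUnit_restrict {n : ℕ} (hε : RingHom.ker ε ^ n = ⊥) (s : AlgHolFun A V) (x : V)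
    (hx : ε (eval x s) ≠ 0) :
    ∃ (W : Opens RiemannSphere) (h : W ≤ V), x.1 ∈ W ∧ IsUnit (restrict A h s) := by
  rw [← body_apply] at hx
  obtain ⟨W, h, hxW, hW⟩ := HolFun.exists_restrict_ne_zero _ x hx
  refine ⟨W, h, hxW, isUnit_of_body_ne_zero ε hε _ fun y => ?_⟩
  have := hW y
  rwa [HolFun.restrict_apply, body_apply, ← eval_restrict h] at this

end Body

/-! ### Nilpotent vector fields and their flows. -/

section Derivation

/-- The `A`-linear extension of `d/dz`. -/
noncomputable def derivation (A : Type u) [CommRing A] [Algebra ℂ A] (V : Opens RiemannSphere) :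
    AlgHolFun A V →ₗ[A] AlgHolFun A V :=
  ((HolFun.derivation V).baseChange A : A ⊗[ℂ] HolFun V →ₗ[A] A ⊗[ℂ] HolFun V)

theorem derivation_tmul (c : A) (f : HolFun V) :
    derivation A V (tmul c f) = tmul c (HolFun.derivation V f) := rfl

theorem derivation_mul (s t : AlgHolFun A V) :
    derivation A V (s * t) = s * derivation A V t + derivation A V s * t := by
  induction s using induction_on with
  | zero => simp
  | add s s' hs hs' => rw [add_mul, map_add, hs, hs', map_add]; ring
  | tmul a f =>
    induction t using induction_on with
    | zero => simp
    | add t t' ht ht' => rw [mul_add, map_add, ht, ht', map_add]; ring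
    | tmul b g =>
      simp only [tmul_mul_tmul, derivation_tmul, HolFun.derivation_mul, tmul_add]

theorem derivation_restrict (h : W ≤ V) (s : AlgHolFun A V) :
    derivation A W (restrict A h s) = restrict A h (derivation A V s) := by
  induction s using induction_on with
  | zero => simp
  | tmul a f =>
    simp only [restrict_tmul, derivation_tmul, HolFun.derivation_restrict]
  | add s t hs ht => simp only [map_add, hs, ht]

/-- The vector field `a · d/dz`. -/
noncomputable def vectorField (a : AlgHolFun A V) :
    AlgHolFun A V →ₗ[A] AlgHolFun A V :=
  LinearMap.mulLeft _ a ∘ₗ derivation A V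

theorem vectorField_apply (a s : AlgHolFun A V) : vectorField a s = a * derivation A V s := rfl

theorem vectorField_mul (a s t : AlgHolFun A V) :
    vectorField a (s * t) = s * vectorField a t + vectorField a s * t := by
  simp only [vectorField_apply, derivation_mul]; ring

theorem vectorField_restrict (h : W ≤ V) (a : AlgHolFun A V) :
    vectorField (restrict A h a) ∘ₗ (restrict A h).toLinearMap =
      (restrict A h).toLinearMap ∘ₗ vectorField a := by
  refine LinearMap.ext fun s => ?_
  simp only [LinearMap.comp_apply, AlgHom.toLinearMap_apply, vectorField_apply,
    derivation_restrict, map_mul]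

variable {J : Ideal A} {a : AlgHolFun A V}

theorem vectorField_mem (ha : ∀ x, eval x a ∈ J) (s : AlgHolFun A V) :
    vectorField a s ∈ J • (⊤ : Submodule A (AlgHolFun A V)) := by
  rw [mem_smul_top_iff]
  intro x
  rw [vectorField_apply, map_mul]
  exact J.mul_mem_right _ (ha x)

/-- A-linearity makes each application of the field gain one factor J. Hence a field with values in
a nilpotent ideal is nilpotent, and its exponential series is finite. -/
theorem vectorField_pow_mem (ha : ∀ x, eval x a ∈ J) (k : ℕ) (s : AlgHolFun A V) :
    (vectorField a ^ k) s ∈ J ^ k • (⊤ : Submodule A (AlgHolFun A V)) := by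
  induction k with
  | zero => rw [pow_zero, Ideal.one_eq_top, Submodule.top_smul]; trivial
  | succ k ih =>
    rw [pow_succ' (vectorField a), Module.End.mul_apply, pow_succ J, ← smul_eq_mul,
      Submodule.smul_assoc]
    exact Submodule.map_mem_smul_of_forall_mem _ (vectorField_mem ha) ih

theorem isNilpotent_vectorField {n : ℕ} (hJ : J ^ n = ⊥) (ha : ∀ x, eval x a ∈ J) :
    IsNilpotent (vectorField a) :=
  ⟨n, LinearMap.ext fun s => by
    have h := vectorField_pow_mem ha n s
    rwa [hJ, Submodule.bot_smul, Submodule.mem_bot] at h⟩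

/-- The flow `exp (a · d/dz)` of a nilpotent vector field, an automorphism of `A ⊗ 𝒪`. -/
noncomputable def flow (a : AlgHolFun A V) (h : IsNilpotent (vectorField a)) :
    AlgHolFun A V ≃ₐ[A] AlgHolFun A V :=
  have hmul := Module.End.exp_mul_of_derivation A _ (vectorField a) (vectorField_mul a) h
  have hl : ∀ s, IsNilpotent.exp (vectorField a) (IsNilpotent.exp (-vectorField a) s) = s :=
    fun s => LinearMap.congr_fun (IsNilpotent.exp_mul_exp_neg_self h) s
  have hr : ∀ s, IsNilpotent.exp (-vectorField a) (IsNilpotent.exp (vectorField a) s) = s :=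
    fun s => LinearMap.congr_fun (IsNilpotent.exp_neg_mul_exp_self h) s
  AlgEquiv.ofLinearEquiv
    (LinearEquiv.ofLinearMap (IsNilpotent.exp (vectorField a)) (IsNilpotent.exp (-vectorField a))
      (LinearMap.ext hl) (LinearMap.ext hr))
    (by
      -- Multiplicativity and surjectivity force the unit to be preserved: multiply 1 by the
      -- preimage of 1.
      have h1 := hmul 1 (IsNilpotent.exp (-vectorField a) 1)
      rw [one_mul, hl, mul_one] at h1
      exact h1.symm)
    hmul

theorem flow_apply (a : AlgHolFun A V) (h : IsNilpotent (vectorField a)) (s : AlgHolFun A V) :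
    flow a h s = IsNilpotent.exp (vectorField a) s := rfl

theorem flow_restrict (h : W ≤ V) (a : AlgHolFun A V) (ha : IsNilpotent (vectorField a))
    (ha' : IsNilpotent (vectorField (restrict A h a))) (s : AlgHolFun A V) :
    flow (restrict A h a) ha' (restrict A h s) = restrict A h (flow a ha s) :=
  LinearMap.congr_fun
    (Module.End.commute_exp_left_of_commute ha ha' (vectorField_restrict h a)) s

/-- All terms of order at least two in the exponential series lie in J². -/
theorem flow_sub_mem {n : ℕ} (hJ : J ^ n = ⊥) (ha : ∀ x, eval x a ∈ J)
    (h : IsNilpotent (vectorField a)) (s : AlgHolFun A V) (x : V) :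
    eval x (flow a h s) - eval x s - eval x a * eval x (derivation A V s) ∈ J ^ 2 := by
  -- The exponent n + 2, rather than n, lets the terms of order 0 and 1 be split off for every n.
  have hn : vectorField a ^ (n + 2) = 0 :=
    LinearMap.ext fun s => by
      have h := vectorField_pow_mem ha (n + 2) s
      rwa [pow_add, hJ, ← Ideal.zero_eq_bot, zero_mul, Ideal.zero_eq_bot, Submodule.bot_smul,
        Submodule.mem_bot] at h
  have h0 : flow a h s = (∑ i ∈ Finset.range n, ((i + 1 + 1).factorial : ℚ)⁻¹ •
      (vectorField a ^ (i + 1 + 1)) s) + a * derivation A V s + s := by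
    rw [flow_apply, IsNilpotent.exp_eq_sum hn, Finset.sum_range_succ', Finset.sum_range_succ']
    simp [vectorField_apply]
  have h1 : ∑ i ∈ Finset.range n, ((i + 1 + 1).factorial : ℚ)⁻¹ •
      (vectorField a ^ (i + 1 + 1)) s ∈ J ^ 2 • (⊤ : Submodule A (AlgHolFun A V)) := by
    refine Submodule.sum_mem _ fun i _ => ?_
    have h2 : (vectorField a ^ (i + 1 + 1)) s ∈ J ^ 2 • (⊤ : Submodule A (AlgHolFun A V)) :=
      Submodule.smul_mono_left (Ideal.pow_le_pow_right (by omega))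
        (vectorField_pow_mem ha (i + 1 + 1) s)
    rw [← Rat.cast_smul_eq_qsmul ℂ]
    exact Submodule.smul_of_tower_mem _ _ h2
  have h3 := (mem_smul_top_iff _).1 h1 x
  rw [h0, map_add, map_add, map_mul]
  convert h3 using 1
  ring

end Derivation

end AlgHolFun

/-- A linear stand-in for the quotient J/J': since π kills J', it turns cocycles modulo J' into
exact ones, and on J it changes nothing modulo J'. It is the projection along J' followed by one
onto J. -/
theorem Submodule.exists_linearMap_of_ideal_le {A : Type*} [CommRing A] [Algebra ℂ A]
    {J J' : Ideal A} (h : J' ≤ J) :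
    ∃ π : A →ₗ[ℂ] A, (∀ c, π c ∈ J) ∧ (∀ c ∈ J', π c = 0) ∧ ∀ c ∈ J, c - π c ∈ J' := by
  obtain ⟨q, hq⟩ := LinearMap.exists_leftInverse_of_injective
    (J.restrictScalars ℂ).subtype (Submodule.ker_subtype _)
  obtain ⟨p, hp⟩ := LinearMap.exists_leftInverse_of_injective
    (J'.restrictScalars ℂ).subtype (Submodule.ker_subtype _)
  have hq' : ∀ c ∈ J, (q c : A) = c := fun c hc =>
    congrArg Subtype.val (LinearMap.congr_fun hq (⟨c, hc⟩ : J.restrictScalars ℂ))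
  have hp' : ∀ c ∈ J', (p c : A) = c := fun c hc =>
    congrArg Subtype.val (LinearMap.congr_fun hp (⟨c, hc⟩ : J'.restrictScalars ℂ))
  have hpm : ∀ c, (p c : A) ∈ J' := fun c => (p c).2
  let r : A →ₗ[ℂ] A := LinearMap.id - (J'.restrictScalars ℂ).subtype ∘ₗ p
  have hr : ∀ c, r c = c - p c := fun _ => rfl
  refine ⟨(J.restrictScalars ℂ).subtype ∘ₗ q ∘ₗ r, fun c => (q (r c)).2, fun c hc => ?_,
    fun c hc => ?_⟩
  · change ((q (r c) : J.restrictScalars ℂ) : A) = 0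
    rw [hr, hp' c hc, sub_self, map_zero]; rfl
  · change c - ((q (r c) : J.restrictScalars ℂ) : A) ∈ J'
    rw [hq' _ (by rw [hr]; exact J.sub_mem hc (h (hpm c))), hr, sub_sub_cancel]
    exact hpm c

/-! ### First-order form of automorphisms of A ⊗ 𝒪. -/

namespace AlgHolFun

variable {A : Type u} [CommRing A] [Algebra ℂ A] {V W : Opens RiemannSphere}

/-- Holomorphic functions as sections of `A ⊗ 𝒪`. -/
noncomputable def ofHol : HolFun V →ₐ[ℂ] AlgHolFun A V :=
  (Algebra.TensorProduct.includeRight : HolFun V →ₐ[ℂ] A ⊗[ℂ] HolFun V)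

theorem tmul_eq_smul (c : A) (f : HolFun V) : tmul c f = c • ofHol f := by
  change tmul c f = c • tmul 1 f
  rw [smul_tmul, mul_one]

theorem eval_ofHol (f : HolFun V) (x : V) : eval x (ofHol f : AlgHolFun A V) = algebraMap ℂ A (f x) :=
  (eval_tmul x 1 f).trans (Algebra.algebraMap_eq_smul_one _).symm

theorem derivation_ofHol (f : HolFun V) :
    derivation A V (ofHol f) = ofHol (HolFun.derivation V f) := rfl

theorem restrict_ofHol (h : W ≤ V) (f : HolFun V) :
    restrict A h (ofHol f) = ofHol (HolFun.restrict h f) := rfl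

theorem restrict_restrict {T : Opens RiemannSphere} (h : W ≤ V) (h' : T ≤ W) (s : AlgHolFun A V) :
    restrict A h' (restrict A h s) = restrict A (h'.trans h) s :=
  ext_eval fun x => by simp only [eval_restrict]

theorem eval_derivation_mem {J : Ideal A} {s : AlgHolFun A V} (hs : ∀ x, eval x s ∈ J) (x : V) :
    eval x (derivation A V s) ∈ J := by
  have h := Submodule.map_mem_smul_of_forall_mem (derivation A V) (K := ⊤) (fun _ => trivial)
    ((mem_smul_top_iff J).2 hs)
  exact (mem_smul_top_iff J).1 h x

/-- An `A`-algebra endomorphism of `A ⊗ 𝒪(V)` that is the identity modulo `J` is, modulo `J ^ 2`,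
of the form `1 + a · d/dz`. -/
theorem eval_sub_sub_mem {J : Ideal A} (g : AlgHolFun A V →ₐ[A] AlgHolFun A V)
    (hg : ∀ t x, eval x (g t) - eval x t ∈ J) (hV : OnePoint.infty ∉ V) (t : AlgHolFun A V)
    (x : V) :
    eval x (g t) - eval x t - eval x (g (ofHol (HolFun.coord hV)) - ofHol (HolFun.coord hV)) *
      eval x (derivation A V t) ∈ J ^ 2 := by
  obtain ⟨x, hx⟩ := x
  induction x using OnePoint.rec with
  | infty => exact absurd hx hV
  | coe z =>
    set Z : AlgHolFun A V := ofHol (HolFun.coord hV) with hZ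
    set x : V := ⟨z, hx⟩
    have hd : eval x (g Z - Z) ∈ J := by rw [map_sub]; exact hg Z x
    have hg' : ∀ c : ℂ, g (algebraMap ℂ _ c) = algebraMap ℂ _ c := fun c => by
      rw [IsScalarTower.algebraMap_apply ℂ A (AlgHolFun A V), g.commutes]
    have hgs : ∀ (c : ℂ) (u : AlgHolFun A V), g (c • u) = c • g u := fun c u =>
      g.toLinearMap.map_smul_of_tower c u
    have hes : ∀ (c : ℂ) (u : AlgHolFun A V), eval x (c • u) = c • eval x u := fun c u =>
      (eval x).toLinearMap.map_smul_of_tower c u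
    have hec : ∀ c : ℂ, eval x (algebraMap ℂ (AlgHolFun A V) c) = algebraMap ℂ A c := fun c => by
      rw [IsScalarTower.algebraMap_apply ℂ A (AlgHolFun A V), AlgHom.commutes]; rfl
    have hζ : eval x (Z - algebraMap ℂ _ z) = 0 := by
      rw [map_sub, hec, hZ, eval_ofHol]
      exact sub_self _
    have hgζ : eval x (g (Z - algebraMap ℂ _ z)) = eval x (g Z - Z) := by
      have h1 : g (Z - algebraMap ℂ _ z) = (g Z - Z) + (Z - algebraMap ℂ _ z) := by
        rw [map_sub, hg']; ring
      rw [h1, map_add, hζ, add_zero]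
    induction t using induction_on with
    | zero => simp
    | add s t hs ht =>
      have := add_mem hs ht
      simp only [map_add]
      convert this using 1
      ring
    | tmul c f =>
      -- Write f = f(z) + f'(z)ζ + ζ²h with ζ = Z - z. At x the section ζ vanishes and gζ takes the
      -- value of gZ - Z, which is in J. The linear term is thus the claimed one and the quadratic
      -- term lies in J².
      obtain ⟨h, hh⟩ := HolFun.exists_taylor hV f hx
      have hf : (ofHol f : AlgHolFun A V) = algebraMap ℂ _ (f x) +
          HolFun.derivation V f x • (Z - algebraMap ℂ _ z) +
          (Z - algebraMap ℂ _ z) ^ 2 * ofHol h := by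
        conv_lhs => rw [hh]
        simp only [map_add, map_mul, map_pow, map_sub, map_smul, AlgHom.commutes]
        rfl
      have h1 : eval x (g (ofHol f)) = algebraMap ℂ A (f x) +
          algebraMap ℂ A (HolFun.derivation V f x) * eval x (g Z - Z) +
          eval x (g Z - Z) ^ 2 * eval x (g (ofHol h)) := by
        rw [hf, map_add, map_add, map_mul, map_pow, map_add, map_add, map_mul, map_pow, hg', hgs,
          hec, hes, hgζ, Algebra.smul_def]
      have h2 : eval x (g (tmul c f)) - eval x (tmul c f) - eval x (g Z - Z) *
          eval x (derivation A V (tmul c f)) =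
            c * (eval x (g Z - Z) ^ 2 * eval x (g (ofHol h))) := by
        simp only [tmul_eq_smul, map_smul, h1, derivation_ofHol, eval_ofHol, smul_eq_mul]
        ring
      rw [h2]
      exact Ideal.mul_mem_left _ _ (Ideal.mul_mem_right _ _ (Ideal.pow_mem_pow hd 2))

end AlgHolFun

/-! ### Local trivializations and the displacements of their transition maps. -/

/-- A compatible family of isomorphisms between the restrictions to `U` of a presheaf `S` of
`A`-algebras on `ℙ¹` and of `A ⊗ 𝒪`. -/
structure Trivialization {A : Type u} [CommRing A] [Algebra ℂ A]
    {S : Opens RiemannSphere → Type*} [∀ V, CommRing (S V)] [∀ V, Algebra A (S V)]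
    (res : ∀ {V W : Opens RiemannSphere}, W ≤ V → S V →ₐ[A] S W) (U : Opens RiemannSphere) where
  /-- The isomorphism over `V ⊆ U`. -/
  equiv : ∀ V : Opens RiemannSphere, V ≤ U → S V ≃ₐ[A] AlgHolFun A V
  /-- Compatibility with restrictions. -/
  equiv_res : ∀ (V W : Opens RiemannSphere) (hV : V ≤ U) (h : W ≤ V) (s : S V),
    equiv W (h.trans hV) (res h s) = AlgHolFun.restrict A h (equiv V hV s)

namespace Trivialization

open AlgHolFun

variable {A : Type u} [CommRing A] [Algebra ℂ A]
  {S : Opens RiemannSphere → Type*} [∀ V, CommRing (S V)] [∀ V, Algebra A (S V)]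
  {res : ∀ {V W : Opens RiemannSphere}, W ≤ V → S V →ₐ[A] S W} {U U' : Opens RiemannSphere}

/-- Restriction of a trivialization to a smaller open subset. -/
def restrict (e : Trivialization res U) (h : U' ≤ U) : Trivialization res U' where
  equiv V hV := e.equiv V (hV.trans h)
  equiv_res V W hV := e.equiv_res V W (hV.trans h)

/-- Agreement of trivializations modulo an ideal of `A`. -/
def AgreeMod (e : Trivialization res U) (e' : Trivialization res U') (J : Ideal A) : Prop :=
  ∀ (V : Opens RiemannSphere) (hV : V ≤ U) (hV' : V ≤ U') (s : S V) (x : V),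
    eval x (e.equiv V hV s) - eval x (e'.equiv V hV' s) ∈ J

theorem eval_equiv_res (e : Trivialization res U) {V W : Opens RiemannSphere} (hV : V ≤ U)
    (h : W ≤ V) (s : S V) (x : W) :
    eval x (e.equiv W (h.trans hV) (res h s)) = eval ⟨x.1, h x.2⟩ (e.equiv V hV s) := by
  rw [e.equiv_res V W hV h, eval_restrict]

/-- If the bodies differed at x, subtracting the constant c, the body of s at x under e', would
leave a section that is a unit near x under e but has body 0 at x under e'. Being a unit is
intrinsic to S, a contradiction. -/
theorem agreeMod_ker (e : Trivialization res U) (e' : Trivialization res U') (ε : A →ₐ[ℂ] ℂ)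
    {n : ℕ} (hε : RingHom.ker ε ^ n = ⊥) : AgreeMod e e' (RingHom.ker ε) := by
  intro V hV hV' s x
  by_contra hne
  rw [RingHom.mem_ker, map_sub] at hne
  set c : ℂ := ε (eval x (e'.equiv V hV' s))
  set t : S V := s - algebraMap A (S V) (algebraMap ℂ A c) with ht
  have hev : ∀ {T : Opens RiemannSphere} (f : Trivialization res T) (hT : V ≤ T),
      ε (eval x (f.equiv V hT t)) = ε (eval x (f.equiv V hT s)) - c := by
    intro T f hT
    rw [ht, map_sub, map_sub, map_sub, AlgEquiv.commutes, AlgHom.commutes]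
    congr 1
    exact ε.commutes c
  obtain ⟨W, h, hx, hu⟩ := exists_isUnit_restrict ε hε (e.equiv V hV t) x (by rw [hev]; exact hne)
  rw [← e.equiv_res V W hV h] at hu
  have hu' : IsUnit (res h t) := by
    have := hu.map (e.equiv W (h.trans hV)).symm
    rwa [AlgEquiv.symm_apply_apply] at this
  have hu'' := ((hu'.map (e'.equiv W (h.trans hV'))).map (eval ⟨x.1, hx⟩)).map ε
  rw [e'.eval_equiv_res hV' h, hev e' hV', sub_self] at hu''
  exact not_isUnit_zero hu''

/-- Composition of a trivialization with the flow of a vector field. -/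
noncomputable def flow (e : Trivialization res U) (a : AlgHolFun A U)
    (ha : ∀ V (h : V ≤ U), IsNilpotent (vectorField (AlgHolFun.restrict A h a))) :
    Trivialization res U where
  equiv V hV := (e.equiv V hV).trans (AlgHolFun.flow (AlgHolFun.restrict A hV a) (ha V hV))
  equiv_res V W hV h s := by
    simp only [AlgEquiv.trans_apply]
    rw [e.equiv_res V W hV h]
    have h1 := AlgHolFun.flow_restrict h (AlgHolFun.restrict A hV a) (ha V hV)
      (by rw [AlgHolFun.restrict_restrict]; exact ha W (h.trans hV)) (e.equiv V hV s)
    rw [← h1]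
    congr 2
    rw [AlgHolFun.restrict_restrict]

section Shift

variable (e : Trivialization res U) (e' : Trivialization res U') {V W : Opens RiemannSphere}

/-- The transition map `e ∘ e'⁻¹` over `V`. -/
noncomputable def transition (hV : V ≤ U) (hV' : V ≤ U') : AlgHolFun A V →ₐ[A] AlgHolFun A V :=
  (((e'.equiv V hV').symm.trans (e.equiv V hV)) : AlgHolFun A V ≃ₐ[A] AlgHolFun A V)

theorem transition_equiv (hV : V ≤ U) (hV' : V ≤ U') (s : S V) :
    transition e e' hV hV' (e'.equiv V hV' s) = e.equiv V hV s := by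
  simp [transition]

/-- The displacement of the coordinate function under the transition map. -/
noncomputable def shift (hV : V ≤ U) (hV' : V ≤ U') (h : OnePoint.infty ∉ V) : AlgHolFun A V :=
  transition e e' hV hV' (ofHol (HolFun.coord h)) - ofHol (HolFun.coord h)

/-- Transition maps and the coordinate function commute with restriction, so displacements on
different overlaps can be compared on a common smaller set. -/
theorem eval_shift_of_le (hV : V ≤ U) (hV' : V ≤ U') (h : OnePoint.infty ∉ V) (hW : W ≤ V) (x : W) :
    eval x (shift e e' (hW.trans hV) (hW.trans hV') fun h' => h (hW h')) =
      eval ⟨x.1, hW x.2⟩ (shift e e' hV hV' h) := by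
  rw [← eval_restrict hW]
  congr 1
  rw [shift, shift, map_sub, restrict_ofHol, HolFun.restrict_coord]
  congr 1
  obtain ⟨s, hs⟩ := (e'.equiv V hV').surjective (ofHol (HolFun.coord h))
  rw [← hs, transition_equiv, ← e.equiv_res V W hV hW, ← transition_equiv e e' _ (hW.trans hV'),
    e'.equiv_res V W hV' hW, hs, restrict_ofHol, HolFun.restrict_coord]

variable {e e'} {J : Ideal A}

theorem AgreeMod.transition_sub_mem (H : AgreeMod e e' J) (hV : V ≤ U) (hV' : V ≤ U')
    (t : AlgHolFun A V) (x : V) : eval x (transition e e' hV hV' t) - eval x t ∈ J := by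
  obtain ⟨s, rfl⟩ := (e'.equiv V hV').surjective t
  rw [transition_equiv]
  exact H V hV hV' s x

theorem AgreeMod.shift_mem (H : AgreeMod e e' J) (hV : V ≤ U) (hV' : V ≤ U')
    (h : OnePoint.infty ∉ V) (x : V) : eval x (shift e e' hV hV' h) ∈ J := by
  rw [shift, map_sub]
  exact H.transition_sub_mem hV hV' _ x

theorem AgreeMod.sub_sub_mem (H : AgreeMod e e' J) (hV : V ≤ U) (hV' : V ≤ U')
    (h : OnePoint.infty ∉ V) (s : S V) (x : V) :
    eval x (e.equiv V hV s) - eval x (e'.equiv V hV' s) -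
      eval x (shift e e' hV hV' h) * eval x (derivation A V (e'.equiv V hV' s)) ∈ J ^ 2 := by
  have := eval_sub_sub_mem (transition e e' hV hV') (H.transition_sub_mem hV hV') h
    (e'.equiv V hV' s) x
  rwa [transition_equiv] at this

theorem AgreeMod.derivation_sub_mem (H : AgreeMod e e' J) (hV : V ≤ U) (hV' : V ≤ U') (s : S V)
    (x : V) : eval x (derivation A V (e.equiv V hV s)) -
      eval x (derivation A V (e'.equiv V hV' s)) ∈ J := by
  rw [← map_sub, ← map_sub]
  exact eval_derivation_mem (fun x => by rw [map_sub]; exact H V hV hV' s x) x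

/-- Composing 1 + a·d/dz with 1 + b·d/dz adds a and b modulo J². Concretely, take s with e''s = z:
then d/dz(e's) is 1 modulo J, and its error is multiplied by a displacement in J. -/
theorem AgreeMod.shift_cocycle {U'' : Opens RiemannSphere} {e'' : Trivialization res U''}
    (H : AgreeMod e e' J) (H' : AgreeMod e' e'' J) (hV : V ≤ U) (hV' : V ≤ U') (hV'' : V ≤ U'')
    (h : OnePoint.infty ∉ V) (x : V) :
    eval x (shift e e'' hV hV'' h) - (eval x (shift e e' hV hV' h) +
      eval x (shift e' e'' hV' hV'' h)) ∈ J ^ 2 := by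
  obtain ⟨s, hs⟩ := (e''.equiv V hV'').surjective (ofHol (HolFun.coord h))
  have h1 := H.sub_sub_mem hV hV' h s x
  have h2 := H'.derivation_sub_mem hV' hV'' s x
  have h3 : eval x (derivation A V (e''.equiv V hV'' s)) = 1 := by
    rw [hs, derivation_ofHol, eval_ofHol]
    obtain ⟨x, hx⟩ := x
    induction x using OnePoint.rec with
    | infty => exact absurd hx h
    | coe z =>
      have : HolFun.derivation V (HolFun.coord h) ⟨z, hx⟩ = 1 := by
        rw [HolFun.derivation_apply, HolFun.derivFun_coe]
        have h4 : (fun w : ℂ => (HolFun.coord h).extend w) =ᶠ[nhds z] fun w => w := by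
          filter_upwards [HolFun.eventually_coe_mem hx] with w hw
          rw [HolFun.extend_of_mem _ hw, HolFun.coord_apply]
        rw [h4.deriv_eq, deriv_id'']
      rw [this, map_one]
  have h5 := Ideal.mul_mem_mul (H.shift_mem hV hV' h x) h2
  rw [← pow_two, h3] at h5
  have h6 : eval x (shift e e'' hV hV'' h) =
      eval x (e.equiv V hV s) - eval x (e''.equiv V hV'' s) := by
    rw [shift, ← hs, transition_equiv, map_sub]
  have h7 : eval x (shift e' e'' hV' hV'' h) =
      eval x (e'.equiv V hV' s) - eval x (e''.equiv V hV'' s) := by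
    rw [shift, ← hs, transition_equiv, map_sub]
  rw [h6, h7]
  convert add_mem h1 h5 using 1
  ring

end Shift

end Trivialization

theorem RiemannSphere.exists_radius {V : Opens RiemannSphere} (h : OnePoint.infty ∈ V) :
    ∃ R : ℝ, ∀ z : ℂ, R < ‖z‖ → (z : RiemannSphere) ∈ V := by
  have h1 := RiemannSphere.tendsto_coe_cobounded.eventually (V.isOpen.mem_nhds h)
  obtain ⟨R, -, hR⟩ := Filter.hasBasis_cobounded_norm.eventually_iff.1 h1
  exact ⟨R, fun z hz => hR (show R ≤ ‖z‖ from hz.le)⟩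

/-! ### Splitting the cocycle and improving agreement order by order. -/

namespace Trivialization

open AlgHolFun

variable {A : Type u} [CommRing A] [Algebra ℂ A]
  {S : Opens RiemannSphere → Type*} [∀ V, CommRing (S V)] [∀ V, Algebra A (S V)]
  {res : ∀ {V W : Opens RiemannSphere}, W ≤ V → S V →ₐ[A] S W}

/-- The open subset `ℙ¹ ∖ {∞}`. -/
def finitePart : Opens RiemannSphere := ⟨{OnePoint.infty}ᶜ, isOpen_compl_singleton⟩

theorem infty_notMem_inf_finitePart (V : Opens RiemannSphere) :
    OnePoint.infty ∉ V ⊓ finitePart := fun h => h.2 rfl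

theorem coe_mem_inf_finitePart {V : Opens RiemannSphere} {z : ℂ} (h : (z : RiemannSphere) ∈ V) :
    (z : RiemannSphere) ∈ V ⊓ finitePart := ⟨h, OnePoint.coe_ne_infty z⟩

/-- Splitting of the displacements of the coordinate function. -/
theorem exists_splitting [Module.Finite ℂ A] {ι : Type*} (U : ι → Opens RiemannSphere)
    (hcov : ∀ x, ∃ i, x ∈ U i) (hinf : ∃ i₀, ∀ i, OnePoint.infty ∈ U i ↔ i = i₀)
    (e : ∀ i, Trivialization res (U i)) {J J' : Ideal A} (hJ : J' ≤ J) (hJ2 : J ^ 2 ≤ J')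
    (H : ∀ i j, AgreeMod (e i) (e j) J) :
    ∃ a : ∀ i, AlgHolFun A (U i), (∀ i x, eval x (a i) ∈ J) ∧
      ∀ i j V (hV : V ≤ U i) (hV' : V ≤ U j) (h : OnePoint.infty ∉ V) (x : V),
        eval x (shift (e i) (e j) hV hV' h) -
          (eval ⟨x.1, hV x.2⟩ (a i) - eval ⟨x.1, hV' x.2⟩ (a j)) ∈ J' := by
  obtain ⟨i₀, hi₀⟩ := hinf
  obtain ⟨R, hR⟩ := RiemannSphere.exists_radius ((hi₀ i₀).2 rfl)
  obtain ⟨π, hπJ, hπ0, hπ⟩ := Submodule.exists_linearMap_of_ideal_le hJ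
  let b := Module.finBasis ℂ A
  let V₀ : ι → ι → Opens RiemannSphere := fun i j => U i ⊓ U j ⊓ finitePart
  let d : ∀ i j, AlgHolFun A (V₀ i j) := fun i j =>
    shift (e i) (e j) (inf_le_left.trans inf_le_left) (inf_le_left.trans inf_le_right)
      (infty_notMem_inf_finitePart _)
  let c : Fin (Module.finrank ℂ A) → ι → ι → ℂ → ℂ := fun n i j z =>
    (coeff b n (mapValue π (d i j))).extend z
  have hmem : ∀ {i j} {z : ℂ}, (z : RiemannSphere) ∈ U i → (z : RiemannSphere) ∈ U j →
      (z : RiemannSphere) ∈ V₀ i j := fun hi hj => coe_mem_inf_finitePart ⟨hi, hj⟩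
  have hc : ∀ n i j (z : ℂ) (hz : (z : RiemannSphere) ∈ V₀ i j),
      c n i j z = b.repr (π (eval ⟨z, hz⟩ (d i j))) n := fun n i j z hz => by
    simp only [c]
    rw [HolFun.extend_of_mem _ hz, coeff_apply, eval_mapValue]
  have hcocyc : ∀ i j k (z : ℂ) (hi : (z : RiemannSphere) ∈ U i) (hj : (z : RiemannSphere) ∈ U j)
      (hk : (z : RiemannSphere) ∈ U k), π (eval ⟨z, hmem hi hk⟩ (d i k)) =
        π (eval ⟨z, hmem hi hj⟩ (d i j)) + π (eval ⟨z, hmem hj hk⟩ (d j k)) := by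
    intro i j k z hi hj hk
    let T : Opens RiemannSphere := U i ⊓ U j ⊓ U k ⊓ finitePart
    have hTi : T ≤ U i := fun x hx => hx.1.1.1
    have hTj : T ≤ U j := fun x hx => hx.1.1.2
    have hTk : T ≤ U k := fun x hx => hx.1.2
    have hT : OnePoint.infty ∉ T := infty_notMem_inf_finitePart _
    have hzT : (z : RiemannSphere) ∈ T := coe_mem_inf_finitePart ⟨⟨hi, hj⟩, hk⟩
    have h1 := hπ0 _ (hJ2 ((H i j).shift_cocycle (H j k) hTi hTj hTk hT ⟨z, hzT⟩))
    rw [map_sub, map_add, sub_eq_zero] at h1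
    have hik : T ≤ V₀ i k := fun x hx => ⟨⟨hTi hx, hTk hx⟩, hx.2⟩
    have hij : T ≤ V₀ i j := fun x hx => ⟨⟨hTi hx, hTj hx⟩, hx.2⟩
    have hjk : T ≤ V₀ j k := fun x hx => ⟨⟨hTj hx, hTk hx⟩, hx.2⟩
    rwa [eval_shift_of_le (e i) (e k) _ _ (infty_notMem_inf_finitePart _) hik,
      eval_shift_of_le (e i) (e j) _ _ (infty_notMem_inf_finitePart _) hij,
      eval_shift_of_le (e j) (e k) _ _ (infty_notMem_inf_finitePart _) hjk] at h1
  -- One scalar Cousin problem for each basis vector of A. The projected displacements π(d) form an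
  -- exact cocycle by `hcocyc`.
  have hsol := fun n => exists_cousin_solution (fun i => {z : ℂ | (z : RiemannSphere) ∈ U i})
    (fun i => HolFun.isOpen_coe_preimage (U i)) (fun z => hcov z) i₀ R hR (c n)
    (fun i j z hz => ((HolFun.analyticAt_extend _
      (hmem hz.1 hz.2)).differentiableAt).differentiableWithinAt)
    (fun i j k z hi hj hk => by
      rw [hc n i k z (hmem hi hk), hc n i j z (hmem hi hj), hc n j k z (hmem hj hk),
        hcocyc i j k z hi hj hk, map_add, Finsupp.add_apply])
  choose β hβd hβ hβlim using hsol
  -- Only the member `i₀` reaches ∞, and there the solution tends to 0, so it extends.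
  have hf := fun i n => HolFun.exists_eq_of_tendsto_zero (V := U i) (β n i) (hβd n i)
    (fun h => by rw [(hi₀ i).1 h]; exact hβlim n)
  choose f hf using hf
  -- A second π forces values in J. The price is πD - π(πD), which lies in J' because πD is in J.
  let a : ∀ i, AlgHolFun A (U i) := fun i => mapValue π (∑ n, tmul (b n) (f i n))
  have ha : ∀ i x, eval x (a i) = π (∑ n, f i n x • b n) := fun i x => by
    simp only [a]
    rw [eval_mapValue, map_sum]
    simp only [eval_tmul]
  refine ⟨a, fun i x => by rw [ha]; exact hπJ _, ?_⟩
  rintro i j V hV hV' h ⟨x, hx⟩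
  induction x using OnePoint.rec with
  | infty => exact absurd hx h
  | coe z =>
    have hi := hV hx
    have hj := hV' hx
    have hVij : V ≤ V₀ i j := fun y hy => ⟨⟨hV hy, hV' hy⟩, fun h' => h (by rwa [← h'])⟩
    have hD : eval ⟨z, hx⟩ (shift (e i) (e j) hV hV' h) = eval ⟨z, hmem hi hj⟩ (d i j) :=
      eval_shift_of_le (e i) (e j) _ _ (infty_notMem_inf_finitePart _) hVij _
    set D : A := eval ⟨z, hmem hi hj⟩ (d i j) with hDdef
    have hDJ : D ∈ J := (H i j).shift_mem _ _ _ _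
    have hsum : ∑ n, f i n ⟨z, hi⟩ • b n - ∑ n, f j n ⟨z, hj⟩ • b n = π D := by
      rw [← Finset.sum_sub_distrib]
      refine Eq.trans (Finset.sum_congr rfl fun n _ => ?_) (b.sum_repr (π D))
      rw [← sub_smul, hf i n z hi, hf j n z hj, hβ n i j z hi hj, hc n i j z (hmem hi hj)]
    rw [hD, ha, ha, ← map_sub, hsum]
    have h1 := add_mem (hπ D hDJ) (hπ _ (hπJ D))
    rwa [sub_add_sub_cancel] at h1

/-- Improvement of the agreement of trivializations by one order. -/
theorem exists_agreeMod_of_agreeMod [Module.Finite ℂ A] {ι : Type*} (U : ι → Opens RiemannSphere)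
    (hcov : ∀ x, ∃ i, x ∈ U i) (hinf : ∃ i₀, ∀ i, OnePoint.infty ∈ U i ↔ i = i₀)
    (e : ∀ i, Trivialization res (U i)) {J J' : Ideal A} (hJ : J' ≤ J) (hJ2 : J ^ 2 ≤ J')
    {n : ℕ} (hn : J ^ n = ⊥) (H : ∀ i j, AgreeMod (e i) (e j) J) :
    ∃ e' : ∀ i, Trivialization res (U i), ∀ i j, AgreeMod (e' i) (e' j) J' := by
  obtain ⟨a, haJ, ha⟩ := exists_splitting U hcov hinf e hJ hJ2 H
  have hres : ∀ i V (h : V ≤ U i) x, eval x (AlgHolFun.restrict A h (-(a i))) ∈ J :=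
    fun i V h x => by rw [eval_restrict, map_neg]; exact J.neg_mem (haJ i _)
  let e' : ∀ i, Trivialization res (U i) := fun i =>
    (e i).flow (-(a i)) fun V h => isNilpotent_vectorField hn (hres i V h)
  have he' : ∀ i V (hV : V ≤ U i) (s : S V) (x : V),
      eval x ((e' i).equiv V hV s) - eval x ((e i).equiv V hV s) +
        eval ⟨x.1, hV x.2⟩ (a i) * eval x (derivation A V ((e i).equiv V hV s)) ∈ J' := by
    intro i V hV s x
    have h1 := hJ2 (flow_sub_mem hn (hres i V hV) (isNilpotent_vectorField hn (hres i V hV))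
      ((e i).equiv V hV s) x)
    have h2 : eval x (AlgHolFun.restrict A hV (-(a i))) = -eval ⟨x.1, hV x.2⟩ (a i) := by
      rw [eval_restrict, map_neg]
    rw [h2, neg_mul, sub_neg_eq_add] at h1
    exact h1
  have key : ∀ i j V (hV : V ≤ U i) (hV' : V ≤ U j) (h : OnePoint.infty ∉ V) (s : S V) (x : V),
      eval x ((e' i).equiv V hV s) - eval x ((e' j).equiv V hV' s) ∈ J' := by
    intro i j V hV hV' h s x
    have h1 := he' i V hV s x
    have h2 := he' j V hV' s x
    have h3 := hJ2 ((H i j).sub_sub_mem hV hV' h s x)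
    have h4 := Ideal.mul_mem_mul (haJ i ⟨x.1, hV x.2⟩) ((H i j).derivation_sub_mem hV hV' s x)
    rw [← pow_two] at h4
    have h5 := J'.mul_mem_right (eval x (derivation A V ((e j).equiv V hV' s))) (ha i j V hV hV' h x)
    -- Writing ∂ for d/dz, modulo J' the new difference is (e_i s - e_j s) - a_i ∂(e_i s) + a_j
    -- ∂(e_j s). Since e_i s and e_j s have the same derivative modulo J, this is (shift - a_i +
    -- a_j) ∂(e_j s), which lies in J'.
    convert add_mem (add_mem (sub_mem h1 h2) h3) (sub_mem h5 (hJ2 h4)) using 1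
    ring
  refine ⟨e', fun i j V hV hV' s x => ?_⟩
  obtain ⟨x, hx⟩ := x
  induction x using OnePoint.rec with
  | infty =>
    obtain ⟨i₀, hi₀⟩ := hinf
    -- At ∞ no two distinct members meet, so there is nothing to compare.
    obtain rfl := (hi₀ i).1 (hV hx)
    obtain rfl := (hi₀ j).1 (hV' hx)
    rw [sub_self]
    exact J'.zero_mem
  | coe z =>
    have h := key i j (V ⊓ finitePart) (inf_le_left.trans hV) (inf_le_left.trans hV')
      (infty_notMem_inf_finitePart _) (res inf_le_left s) ⟨z, coe_mem_inf_finitePart hx⟩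
    rwa [(e' i).eval_equiv_res hV inf_le_left, (e' j).eval_equiv_res hV' inf_le_left] at h

/-- A presheaf on `ℙ¹` that is locally isomorphic to `A ⊗ 𝒪` has local trivializations that agree
on overlaps. -/
theorem exists_agree [Module.Finite ℂ A] {ι : Type*} (U : ι → Opens RiemannSphere)
    (hcov : ∀ x, ∃ i, x ∈ U i) (hinf : ∃ i₀, ∀ i, OnePoint.infty ∈ U i ↔ i = i₀)
    (e : ∀ i, Trivialization res (U i)) (ε : A →ₐ[ℂ] ℂ) {n : ℕ} (hε : RingHom.ker ε ^ n = ⊥) :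
    ∃ e' : ∀ i, Trivialization res (U i), ∀ i j V (hV : V ≤ U i) (hV' : V ≤ U j) (s : S V),
      (e' i).equiv V hV s = (e' j).equiv V hV' s := by
  have key : ∀ k : ℕ, ∃ e' : ∀ i, Trivialization res (U i),
      ∀ i j, AgreeMod (e' i) (e' j) (RingHom.ker ε ^ (k + 1)) := by
    intro k
    induction k with
    | zero => exact ⟨e, fun i j => by rw [zero_add, pow_one]; exact agreeMod_ker _ _ ε hε⟩
    | succ k ih =>
      obtain ⟨e', he'⟩ := ih
      refine exists_agreeMod_of_agreeMod U hcov hinf e' (Ideal.pow_le_pow_right (by omega))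
        ?_ (n := n) ?_ he'
      -- Squaring I^(k+1) gives at least the next power, as 2(k+1) ≥ k+2.
      · rw [← pow_mul]; exact Ideal.pow_le_pow_right (by omega)
      · rw [← pow_mul, mul_comm, pow_mul, hε, pow_succ, ← Ideal.zero_eq_bot, mul_zero]
  obtain ⟨e', he'⟩ := key n
  refine ⟨e', fun i j V hV hV' s => ext_eval fun x => ?_⟩
  have h := he' i j V hV hV' s x
  rw [pow_succ, hε, ← Ideal.zero_eq_bot, zero_mul, Ideal.zero_eq_bot, Ideal.mem_bot] at h
  exact sub_eq_zero.1 h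

end Trivialization

/-! ### Gluing homomorphisms of sheaves of algebras. -/

section Gluing

variable {A : Type u} [CommRing A] {M : Type} [TopologicalSpace M]

/-- Unique gluing for sheaves of algebras along the traces of an open cover. -/
theorem TopCat.Presheaf.existsUnique_gluing_inf
    {G : TopCat.Presheaf (CommAlgCat.{u} A) (TopCat.of M)}
    (hG : TopCat.Presheaf.IsSheaf (G ⋙ forget (CommAlgCat.{u} A))) {ι : Type}
    (U : ι → Opens M) (hcov : ∀ x, ∃ i, x ∈ U i) (V : Opens M)
    (g : ∀ i, G.obj (op (V ⊓ U i)))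
    (hg : ∀ i j, G.map (homOfLE (inf_le_left : (V ⊓ U i) ⊓ (V ⊓ U j) ≤ V ⊓ U i)).op (g i) =
      G.map (homOfLE (inf_le_right : (V ⊓ U i) ⊓ (V ⊓ U j) ≤ V ⊓ U j)).op (g j)) :
    ∃! t : G.obj (op V), ∀ i, G.map (homOfLE (inf_le_left : V ⊓ U i ≤ V)).op t = g i := by
  let F : TopCat.Sheaf (Type u) (TopCat.of M) := ⟨G ⋙ forget (CommAlgCat.{u} A), hG⟩
  let W : ι → Opens (TopCat.of M) := fun i => V ⊓ U i
  let g' : ∀ i, F.1.obj (op (W i)) := g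
  have hg' : TopCat.Presheaf.IsCompatible F.1 W g' := hg
  exact TopCat.Sheaf.existsUnique_gluing' F W V (fun i => homOfLE inf_le_left)
    (fun x hx => by
      obtain ⟨i, hi⟩ := hcov x
      exact Opens.mem_iSup.2 ⟨i, hx, hi⟩) g' hg'

/-- Restriction of sections of a presheaf of algebras. -/
noncomputable abbrev algRes (G : TopCat.Presheaf (CommAlgCat.{u} A) (TopCat.of M)) {V W : Opens M}
    (h : W ≤ V) : G.obj (op V) →ₐ[A] G.obj (op W) :=
  (G.map (homOfLE h).op).hom

theorem algRes_algRes (G : TopCat.Presheaf (CommAlgCat.{u} A) (TopCat.of M)) {V W T : Opens M}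
    (h : W ≤ V) (h' : T ≤ W) (s : G.obj (op V)) :
    algRes G h' (algRes G h s) = algRes G (h'.trans h) s := by
  have h1 : (homOfLE (h'.trans h)).op = (homOfLE h).op ≫ (homOfLE h').op := rfl
  simp only [algRes]
  rw [h1, G.map_comp]
  rfl

/-- Sections of a sheaf of algebras are equal if they are equal locally. -/
theorem eq_of_algRes_eq {G : TopCat.Presheaf (CommAlgCat.{u} A) (TopCat.of M)}
    (hG : TopCat.Presheaf.IsSheaf (G ⋙ forget (CommAlgCat.{u} A))) {ι : Type}
    (U : ι → Opens M) (hcov : ∀ x, ∃ i, x ∈ U i) {V : Opens M} {s t : G.obj (op V)}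
    (h : ∀ i, algRes G (inf_le_left : V ⊓ U i ≤ V) s = algRes G inf_le_left t) : s = t :=
  (TopCat.Presheaf.existsUnique_gluing_inf hG U hcov V
    (fun i => algRes G (inf_le_left : V ⊓ U i ≤ V) t)
    (fun _ _ => (algRes_algRes G _ inf_le_left t).trans
      (algRes_algRes G _ inf_le_right t).symm)).unique h fun _ => rfl

/-- Gluing of homomorphisms of sheaves of algebras. -/
theorem exists_glued_algHom {F G : TopCat.Presheaf (CommAlgCat.{u} A) (TopCat.of M)}
    (hG : TopCat.Presheaf.IsSheaf (G ⋙ forget (CommAlgCat.{u} A))) {ι : Type}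
    (U : ι → Opens M) (hcov : ∀ x, ∃ i, x ∈ U i)
    (f : ∀ i V, V ≤ U i → (F.obj (op V) →ₐ[A] G.obj (op V)))
    (hf : ∀ i V W (hV : V ≤ U i) (h : W ≤ V) s,
      f i W (h.trans hV) (algRes F h s) = algRes G h (f i V hV s))
    (hij : ∀ i j V (hV : V ≤ U i) (hV' : V ≤ U j) s, f i V hV s = f j V hV' s) :
    ∃ φ : ∀ V : Opens M, F.obj (op V) →ₐ[A] G.obj (op V),
      (∀ V W (h : W ≤ V) s, φ W (algRes F h s) = algRes G h (φ V s)) ∧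
      ∀ i V (hV : V ≤ U i) s, φ V s = f i V hV s := by
  have hex : ∀ V (s : F.obj (op V)), ∃! t : G.obj (op V),
      ∀ i, algRes G (inf_le_left : V ⊓ U i ≤ V) t =
        f i (V ⊓ U i) inf_le_right (algRes F inf_le_left s) := fun V s =>
    TopCat.Presheaf.existsUnique_gluing_inf hG U hcov V
      (fun i => f i (V ⊓ U i) inf_le_right (algRes F inf_le_left s)) fun i j => by
        refine (hf i _ _ inf_le_right inf_le_left _).symm.trans
          (Eq.trans ?_ (hf j _ _ inf_le_right inf_le_right _))
        rw [algRes_algRes, algRes_algRes]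
        exact hij i j _ _ _ _
  choose φ hφ huniq using hex
  have hloc : ∀ i V (hV : V ≤ U i) s, φ V s = f i V hV s := fun i V hV s =>
    (huniq V s _ fun j => by
      dsimp only
      rw [← hf i V _ hV inf_le_left]
      exact hij _ _ _ _ _ _).symm
  -- Every algebra law, and below the compatibility with restriction, follows from uniqueness of the
  -- glued section.
  refine ⟨fun V =>
    { toFun := φ V
      map_one' := (huniq V 1 1 fun i => by simp only [map_one]).symm
      map_zero' := (huniq V 0 0 fun i => by simp only [map_zero]).symm
      map_mul' := fun s t => (huniq V (s * t) _ fun i => by simp only [map_mul, hφ]).symm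
      map_add' := fun s t => (huniq V (s + t) _ fun i => by simp only [map_add, hφ]).symm
      commutes' := fun c => (huniq V _ _ fun i => by simp only [AlgHom.commutes]).symm },
    fun V W h s => ?_, hloc⟩
  refine (huniq W (algRes F h s) _ fun i => ?_).symm
  dsimp only
  have h1 := congrArg (algRes G (inf_le_inf_right (U i) h)) (hφ V s i)
  rw [algRes_algRes, ← hf, algRes_algRes] at h1
  rw [algRes_algRes, algRes_algRes]
  exact h1

end Gluing

/-! ### The complexified augmentation and the assembly of the isomorphism. -/

/-- The augmentation of the complexification induced by the body map. -/
theorem exists_augmentation {P : Type u} [CommRing P] [Algebra ℝ P] (bodyMap : P →ₐ[ℝ] ℝ)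
    {n : ℕ} (h : RingHom.ker bodyMap ^ n = ⊥) :
    ∃ ε : Complexification P →ₐ[ℂ] ℂ, RingHom.ker ε ^ n = ⊥ := by
  let ε : Complexification P →ₐ[ℂ] ℂ :=
    Algebra.TensorProduct.lift (AlgHom.id ℂ ℂ) ((Algebra.ofId ℝ ℂ).comp bodyMap)
      fun _ _ => Commute.all _ _
  have hε : ∀ (z : ℂ) (p : P), ε (z ⊗ₜ p) = z * bodyMap p := fun z p => rfl
  let ι : P →ₐ[ℝ] Complexification P := Algebra.TensorProduct.includeRight
  -- This places ker ε inside the ideal generated by ker `bodyMap`, so nilpotency passes to the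
  -- complexification with the same exponent.
  have hdecomp : ∀ c : Complexification P,
      c - algebraMap ℂ _ (ε c) ∈ (RingHom.ker bodyMap).map ι := by
    intro c
    induction c using TensorProduct.induction_on with
    | zero => simp
    | add c d hc hd => rw [map_add, map_add, add_sub_add_comm]; exact add_mem hc hd
    | tmul z p =>
      have h1 : (z ⊗ₜ[ℝ] p : Complexification P) - algebraMap ℂ _ (ε (z ⊗ₜ p)) =
          algebraMap ℂ _ z * ι (p - algebraMap ℝ P (bodyMap p)) := by
        rw [hε, map_sub, AlgHom.commutes, mul_sub]
        congr 1
        · change _ = (z ⊗ₜ[ℝ] (1 : P)) * ((1 : ℂ) ⊗ₜ[ℝ] p)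
          rw [Algebra.TensorProduct.tmul_mul_tmul, mul_one, one_mul]
        · rw [map_mul, IsScalarTower.algebraMap_apply ℝ ℂ (Complexification P)]
          rfl
      rw [h1]
      refine Ideal.mul_mem_left _ _ (Ideal.mem_map_of_mem _ ?_)
      rw [RingHom.mem_ker, map_sub, AlgHom.commutes]
      exact sub_self _
  refine ⟨ε, ?_⟩
  have hle : RingHom.ker ε ≤ (RingHom.ker bodyMap).map ι := by
    intro c hc
    have := hdecomp c
    rwa [RingHom.mem_ker.1 hc, map_zero, sub_zero] at this
  rw [eq_bot_iff]
  refine (Ideal.pow_right_mono hle n).trans ?_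
  rw [← Ideal.map_pow, h, Ideal.map_bot]

/-- The comparison of `𝒫^ℂ ⊗ 𝒪(V)` with `AlgHolFun`. -/
noncomputable def PHolFun.toAlgHolFun {P : Type u} [CommRing P] [Algebra ℝ P]
    (V : Opens RiemannSphere) :
    PHolFun P V ≃ₐ[Complexification P] AlgHolFun (Complexification P) V :=
  (AlgEquiv.refl : PHolFun P V ≃ₐ[Complexification P] PHolFun P V)

theorem PHolFun.toAlgHolFun_restrict {P : Type u} [CommRing P] [Algebra ℝ P]
    {V W : Opens RiemannSphere} (h : W ≤ V) (s : PHolFun P V) :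
    toAlgHolFun W (PHolFun.restrict P h s) =
      AlgHolFun.restrict (Complexification P) h (toAlgHolFun V s) := rfl

theorem mainTheorem7 (P : Type u) [CommRing P] [Algebra ℝ P] [Module.Finite ℝ P]
    (bodyMap : P →ₐ[ℝ] ℝ) (hbody : ∃ n : ℕ, RingHom.ker bodyMap ^ n = ⊥)
    (X : PRiemannSurface P RiemannSphere) :
    ∃ Φ : PMorphism (PRiemannSurface.ofManifold P RiemannSphere) X,
      Φ.IsIso ∧ Φ.body = ContMDiffMap.id := by
  obtain ⟨n, hn⟩ := hbody
  obtain ⟨ε, hε⟩ := exists_augmentation bodyMap hn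
  have hloc : ∀ x : RiemannSphere, ∃ U : Opens RiemannSphere, x ∈ U ∧
      Nonempty (Trivialization (A := Complexification P) (S := fun V => X.sections V)
        (fun h => X.res h) U) := by
    intro x
    obtain ⟨U, hx, e, he⟩ := X.locally_iso x
    exact ⟨U, hx, ⟨fun V hV => (e V hV).trans (PHolFun.toAlgHolFun V), fun V W hV h s =>
      (congrArg (PHolFun.toAlgHolFun W) (he V W hV h s)).trans
        (PHolFun.toAlgHolFun_restrict h _)⟩⟩
  choose U₀ hU₀ e₀ using hloc
  classical
  -- The cover is indexed by points; ∞ is removed from every member except the one indexed by ∞.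
  let U : RiemannSphere → Opens RiemannSphere := fun x =>
    if x = OnePoint.infty then U₀ x else U₀ x ⊓ Trivialization.finitePart
  have hUle : ∀ x, U x ≤ U₀ x := fun x => by
    simp only [U]; split_ifs
    exacts [le_rfl, inf_le_left]
  have hcov : ∀ x, ∃ i, x ∈ U i := fun x => ⟨x, by
    simp only [U]; split_ifs with h
    exacts [hU₀ x, ⟨hU₀ x, h⟩]⟩
  have hinf : ∃ i₀, ∀ i, OnePoint.infty ∈ U i ↔ i = i₀ := by
    refine ⟨OnePoint.infty, fun i => ⟨fun h => ?_, fun h => ?_⟩⟩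
    · by_contra hi
      simp only [U, if_neg hi] at h
      exact h.2 rfl
    · subst h; simpa [U] using hU₀ OnePoint.infty
  obtain ⟨e, he⟩ := Trivialization.exists_agree U hcov hinf
    (fun i => (e₀ i).some.restrict (hUle i)) ε hε
  let f : ∀ i V, V ≤ U i → (X.sections V ≃ₐ[Complexification P] PHolFun P V) := fun i V hV =>
    ((e i).equiv V hV).trans (PHolFun.toAlgHolFun V).symm
  have hf : ∀ i V W (hV : V ≤ U i) (h : W ≤ V) s,
      f i W (h.trans hV) (X.res h s) = PHolFun.restrict P h (f i V hV s) := fun i V W hV h s => by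
    apply (PHolFun.toAlgHolFun W).injective
    rw [PHolFun.toAlgHolFun_restrict]
    simp only [f, AlgEquiv.trans_apply, AlgEquiv.apply_symm_apply]
    exact (e i).equiv_res V W hV h s
  have hfij : ∀ i j V (hV : V ≤ U i) (hV' : V ≤ U j) s, f i V hV s = f j V hV' s :=
    fun i j V hV hV' s => congrArg (PHolFun.toAlgHolFun V).symm (he i j V hV hV' s)
  have hfs : ∀ i V W (hV : V ≤ U i) (h : W ≤ V) s,
      (f i W (h.trans hV)).symm (PHolFun.restrict P h s) = X.res h ((f i V hV).symm s) :=
    fun i V W hV h s => by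
      rw [AlgEquiv.symm_apply_eq, hf i V W hV h, AlgEquiv.apply_symm_apply]
  have hfsij : ∀ i j V (hV : V ≤ U i) (hV' : V ≤ U j) s, (f i V hV).symm s = (f j V hV').symm s :=
    fun i j V hV hV' s => by
      rw [AlgEquiv.symm_apply_eq, hfij i j V hV hV', AlgEquiv.apply_symm_apply]
  obtain ⟨φ, hφres, hφ⟩ := exists_glued_algHom (F := X.presheaf) (G := pHolPresheaf RiemannSphere P)
    (pHolPresheaf_isSheaf RiemannSphere P) U hcov (fun i V hV => (f i V hV).toAlgHom) hf hfij
  obtain ⟨ψ, hψres, hψ⟩ := exists_glued_algHom (F := pHolPresheaf RiemannSphere P) (G := X.presheaf)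
    X.isSheaf U hcov (fun i V hV => (f i V hV).symm.toAlgHom) hfs hfsij
  have hφψ : ∀ V s, φ V (ψ V s) = s := fun V s => by
    refine eq_of_algRes_eq (pHolPresheaf_isSheaf RiemannSphere P) U hcov fun i => ?_
    rw [← hφres, ← hψres, hφ i _ inf_le_right, hψ i _ inf_le_right]
    exact (f i _ _).apply_symm_apply _
  have hψφ : ∀ V s, ψ V (φ V s) = s := fun V s => by
    refine eq_of_algRes_eq X.isSheaf U hcov fun i => ?_
    rw [← hψres, ← hφres, hψ i _ inf_le_right, hφ i _ inf_le_right]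
    exact (f i _ _).symm_apply_apply _
  let Φ : PMorphism (PRiemannSurface.ofManifold P RiemannSphere) X :=
    { body := ContMDiffMap.id
      pullback := φ
      pullback_res := hφres }
  let Ψ : PMorphism X (PRiemannSurface.ofManifold P RiemannSphere) :=
    { body := ContMDiffMap.id
      pullback := ψ
      pullback_res := hψres }
  refine ⟨Φ, ⟨Ψ, ?_, ?_⟩, rfl⟩
  -- All bodies are the identity, so preimages of V are V by definition and both families of
  -- pullbacks have the same type.
  · refine PMorphism.ext rfl (heq_of_eq ?_)
    funext V
    exact AlgHom.ext (hφψ V)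
  · refine PMorphism.ext rfl (heq_of_eq ?_)
    funext V
    exact AlgHom.ext (hψφ V)
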